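/- **Model.** Let $G=(V,E)$ be a finite simple undirected graph (the network; adjacent agents are friends) and $p\in[0,1]$. The state $\theta\in\{0,1\}$ is uniform. Each agent $v\in V$ has a signal $s_v\in\{0,1\}$ with $s_v=\theta$ with probability $p$, and the signals are independent conditional on $\theta$. The arrival times $t_v$, $v\in V$, are independent and uniform on $[0,1]$, and independent of the state and the signals. On arrival, agent $v$ observes $s_v$, the set $F_{v,T}$ of those friends $u$ of $v$ with $t_u<t_v$, and their actions $(a_u)_{u\in F_{v,T}}$ (but not his arrival time), and chooses an action $a_v\in\{0,1\}$ by a mixed strategy $\sigma_v$, which maps this information to a probability distribution on $\{0,1\}$. The payoff of $v$ is $1$ if $a_v=\theta$ and $0$ otherwise. An equilibrium is a profile $\sigma=(\sigma_v)_{v\in V}$ in which no agent $v$ can increase his learning quality $l_\sigma(v)=\mathbb P_\sigma(a_v=\theta)$ by changing his own strategy only. It is state-symmetric if the joint distribution of $(\theta,(s_v)_v,(a_v)_v,(t_v)_v)$ does not change when $\theta$, all $s_v$ and all $a_v$ are simultaneously replaced by $1-\theta$, $1-s_v$, $1-a_v$. **Local learning requirement.** Let $G\setminus v$ be the network obtained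 from $G$ by deleting $v$. Agent $v$ satisfies the local learning requirement with parameters $(d,r,D)$ if he has $d$ distinct friends $u_1,\dots,u_d$, each of degree at least $d$ in $G$, such that the $r$-neighborhoods $\{w : d_{G\setminus v}(u_i,w)\le r\}$ in $G\setminus v$ are pairwise disjoint and every agent in these neighborhoods has degree at most $D$ in $G\setminus v$ (in particular this holds if his degree in $G$ is at most $D$). **Theorem.** Let $d\ge 2$, $r\ge 1$ and $D\ge 0$ be integers, and let $v$ satisfy the local learning requirement with parameters $(d,r,D)$. Put $\psi=2d\left(\frac{eD}{r}\right)^r$ and suppose $p>\frac{1+\psi}{2}$. Then in every state-symmetric equilibrium $\sigma$ $$l_\sigma(v)\ \ge\ 1-\psi-\frac{18}{\sqrt{d-1}\,(2p-1-\psi)}.$$ -/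

import Mathlib

open MeasureTheory ProbabilityTheory

namespace SocialLearning

/-- What an agent knows when he acts: his own signal and, for every agent `u`, either `none`
(`u` is not observed) or `some a` (`u` is observed and took the action `a`).
The two states, signals and actions `1` and `0` are `true` and `false`. -/
abbrev Info (V : Type*) := Bool × (V → Option Bool)

/-- A mixed strategy: to an information set it assigns the probability of the action `true`. -/
abbrev Strategy (V : Type*) := Info V → unitInterval

/-- The sample space. A point `(θ, c, T, ω)` consists of the state `θ`, the indicators `c v` of the
signal of `v` being correct, the arrival times `T v`, and the private randomization devices `ω v`
with which the agents carry out their mixed strategies. -/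
abbrev Sample (V : Type*) := Bool × (V → Bool) × (V → unitInterval) × (V → unitInterval)

/-- All coordinates are independent: the state is a fair coin, each signal is correct with
probability `p`, and arrival times and randomization devices are uniform on `[0, 1]`. -/
noncomputable def prior (V : Type*) [Fintype V] (p : unitInterval) : Measure (Sample V) :=
  (bernoulliMeasure true false (⟨1 / 2, by norm_num, by norm_num⟩ : unitInterval)).prod
    ((Measure.pi fun _ : V => bernoulliMeasure true false p).prod
      ((volume : Measure (V → unitInterval)).prod (volume : Measure (V → unitInterval))))

/-- The private signal of `v`: it equals the state if it is correct and the opposite otherwise. -/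
def signal {V : Type*} (x : Sample V) (v : V) : Bool :=
  if x.2.1 v then x.1 else !x.1

open Classical in
/-- The actions for given signals `s`, arrival times `T` and randomization devices `ω`, by recursion
along the arrival order. Agent `v` observes the friends `u` who arrived strictly earlier, with their
actions, and plays `true` if and only if `ω v` is below the probability that his strategy
prescribes at the resulting information set. -/
noncomputable def play {V : Type*} [Fintype V] (G : SimpleGraph V) (σ : V → Strategy V)
    (s : V → Bool) (T ω : V → unitInterval) (v : V) : Bool :=
  decide (ω v < σ v (s v, fun u =>
    if _h : G.Adj v u ∧ T u < T v then some (play G σ s T ω u) else none))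
termination_by (Finset.univ.filter fun w => T w < T v).card
decreasing_by
  refine Finset.card_lt_card (Finset.ssubset_iff_of_subset ?_ |>.2 ⟨u, ?_, ?_⟩)
  · intro w hw
    simp only [Finset.mem_filter, Finset.mem_univ, true_and] at hw ⊢
    exact hw.trans _h.2
  · simpa using _h.2
  · simp

/-- The action of `v` when the agents play the strategies `σ`. -/
noncomputable def action {V : Type*} [Fintype V] (G : SimpleGraph V) (σ : V → Strategy V)
    (x : Sample V) (v : V) : Bool :=
  play G σ (signal x) x.2.2.1 x.2.2.2 v

/-- The learning quality of `v`: the probability that his action matches the state. It is also his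
expected payoff. -/
noncomputable def learningQuality {V : Type*} [Fintype V] (G : SimpleGraph V) (p : unitInterval)
    (σ : V → Strategy V) (v : V) : ℝ :=
  (prior V p).real {x | action G σ x v = x.1}

open Classical in
/-- A (Bayesian Nash) equilibrium: no agent gains by a unilateral change of his mixed strategy. -/
def IsEquilibrium {V : Type*} [Fintype V] (G : SimpleGraph V) (p : unitInterval)
    (σ : V → Strategy V) : Prop :=
  ∀ (v : V) (τ : Strategy V),
    learningQuality G p (Function.update σ v τ) v ≤ learningQuality G p σ v

/-- The observable outcome `(θ, s, a, T)`: state, signals, actions, arrival times. -/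
abbrev Outcome (V : Type*) := Bool × (V → Bool) × (V → Bool) × (V → unitInterval)

/-- The distribution of the outcome when the agents play the strategies `σ`. -/
noncomputable def outcomeLaw {V : Type*} [Fintype V] (G : SimpleGraph V) (p : unitInterval)
    (σ : V → Strategy V) : Measure (Outcome V) :=
  (prior V p).map fun x => (x.1, signal x, action G σ x, x.2.2.1)

/-- Simultaneous flipping of the state, all signals and all actions. -/
def flipOutcome {V : Type*} (y : Outcome V) : Outcome V :=
  (!y.1, fun v => !y.2.1 v, fun v => !y.2.2.1 v, y.2.2.2)

/-- The distribution of the outcome is invariant under flipping state, signals and actions. -/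
def IsStateSymmetric {V : Type*} [Fintype V] (G : SimpleGraph V) (p : unitInterval)
    (σ : V → Strategy V) : Prop :=
  (outcomeLaw G p σ).map flipOutcome = outcomeLaw G p σ

/-- The network without the agent `v`. -/
abbrev without {V : Type*} (G : SimpleGraph V) (v : V) : SimpleGraph {w : V // w ≠ v} :=
  G.induce {w | w ≠ v}

/-- The closed `r`-neighborhood of `u`. -/
def nbhd {V : Type*} (G : SimpleGraph V) (r : ℕ) (u : V) : Set V :=
  {w | G.edist u w ≤ r}

open Classical in
/-- The local learning requirement with parameters `(d, r, D)`: there are `d` friends of `v`, each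
with at least `d` friends, whose `r`-neighborhoods in the network without `v` are pairwise disjoint
and consist of agents with at most `D` friends other than `v`. -/
def LocalLearningRequirement {V : Type*} [Fintype V] (G : SimpleGraph V) (v : V)
    (d r D : ℕ) : Prop :=
  ∃ S : Finset {w : V // w ≠ v},
    S.card = d ∧
    (∀ u ∈ S, G.Adj v u ∧ d ≤ G.degree u) ∧
    (∀ u ∈ S, ∀ u' ∈ S, u ≠ u' → Disjoint (nbhd (without G v) r u) (nbhd (without G v) r u')) ∧
    (∀ u ∈ S, ∀ w ∈ nbhd (without G v) r u, (without G v).degree w ≤ D)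

/-- The quantity `ψ = 2 d (e D / r) ^ r`. -/
noncomputable def psi (d r D : ℕ) : ℝ :=
  2 * d * (Real.exp 1 * D / r) ^ r

end SocialLearning

open SocialLearning

/-! Let `v` deviate to following the majority of his friends in `S`. In equilibrium his learning
quality is at least that of this deviation (`IsEquilibrium.one_sub_learningQuality_le`), so it
suffices that in each state the right votes among the arrived friends outnumber the wrong ones with
high probability.

Whoever acts before `v` acts as in the network `cut G v` (`play_eq_play_cut`). There the friends are
almost independent: unless a chain of `r` successive observations starts at `u`, the action of `u`
depends only on the noise in his `r`-neighborhood. Such a chain needs arrival times decreasing along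
a path, which has probability at most `D ^ r / (r + 1)!` (`measureReal_descends_le`); `psi` pays for
this. Votes truncated to disjoint neighborhoods are pairwise independent, and Chebyshev's inequality
applies once their means are bounded below.

That bound is the crux, since a friend does not know his arrival time. Equilibrium only says that,
on the event of observing exactly `k` friends but not `v`, `u` does at least as well as his own
signal. Given `T u`, the agent `v` is unobserved with probability `1 - T u`, which distorts the
weight of the arrival times. But `k` is close to `n * T u`, where `n` counts the friends of `u`
other than `v`. Summing the inequalities over `k` with the weights `friendWeight` therefore undoes
the distortion and cuts off at time `t`: the event `T u < t` is restored up to an `L¹` error `(π +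
2) / √n` (`integral_abs_friendWeight_le`). This bounds the score of `u` before `t`, summed over both
states (`IsEquilibrium.sum_integral_cutScore_ge`); state symmetry turns it into a bound in each
state.

With `x = 1 / (√(d - 1) (2p - 1 - ψ))`, Chebyshev's inequality bounds the error of the vote at a
time `t ≥ 15 x` by `x`. Arrivals of `v` before `15 x` are given up. The total loss is at most `ψ +
16 x`. -/

namespace SocialLearning

/-! ### Play along the arrival order: truncation, locality, removal of `v`. -/

section Dynamics

variable {V : Type*}

open Classical in
/-- What `w` observes at arrival times `T` when the others play `a`. -/
noncomputable def observed (G : SimpleGraph V) (T : V → unitInterval) (a : V → Bool) (w : V) :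
    V → Option Bool :=
  fun u => if G.Adj w u ∧ T u < T w then some (a u) else none

/-- The play with the recursion along the arrival order cut off after `n` steps. -/
noncomputable def playN (G : SimpleGraph V) (σ : V → Strategy V) (s : V → Bool)
    (T ω : V → unitInterval) : ℕ → V → Bool
  | 0, _ => false
  | n + 1, w => decide (ω w < σ w (s w, observed G T (playN G σ s T ω n) w))

/-- From `w` there starts a path of `n` edges along which the arrival times decrease. -/
def Descends (G : SimpleGraph V) (T : V → unitInterval) : ℕ → V → Prop
  | 0, _ => True
  | n + 1, w => ∃ u, G.Adj w u ∧ T u < T w ∧ Descends G T n u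

/-- The network `G` with all links of `v` removed, on the same set of agents. -/
def cut (G : SimpleGraph V) (v : V) : SimpleGraph V where
  Adj a b := G.Adj a b ∧ a ≠ v ∧ b ≠ v
  symm := ⟨fun _ _ h => ⟨h.1.symm, h.2.2, h.2.1⟩⟩
  loopless := ⟨fun _ h => h.1.ne rfl⟩

lemma observed_congr {G G' : SimpleGraph V} {T T' : V → unitInterval} {a a' : V → Bool} {w : V}
    (hG : ∀ u, (G.Adj w u ∧ T u < T w) ↔ (G'.Adj w u ∧ T' u < T' w))
    (ha : ∀ u, G.Adj w u → T u < T w → a u = a' u) :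
    observed G T a w = observed G' T' a' w := by
  classical
  funext u
  by_cases h : G.Adj w u ∧ T u < T w
  · simp only [observed, if_pos h, if_pos ((hG u).1 h), ha u h.1 h.2]
  · simp only [observed, if_neg h, if_neg (fun h' => h ((hG u).2 h'))]

lemma observed_eq_none {G : SimpleGraph V} {T : V → unitInterval} {a : V → Bool} {w u : V} :
    observed G T a w u = none ↔ ¬ (G.Adj w u ∧ T u < T w) := by
  classical
  unfold observed
  split_ifs with h <;> simp [h]

/-- Times along the path stay below `s`, so the path never returns to `w`, whose time is `s`, and
the original value of `T w` is irrelevant. -/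
lemma descends_update [DecidableEq V] {G : SimpleGraph V} {T : V → unitInterval} {w : V}
    {s : unitInterval} {n : ℕ} {u : V} (hu : u ≠ w) (hs : T u < s)
    (h : Descends G (Function.update T w s) n u) : Descends G T n u := by
  induction n generalizing u with
  | zero => trivial
  | succ n ih =>
    obtain ⟨x, hx, hlt, hd⟩ := h
    rw [Function.update_of_ne hu] at hlt
    by_cases hxw : x = w
    · subst hxw
      rw [Function.update_self] at hlt
      exact absurd (hlt.trans hs) (lt_irrefl _)
    · rw [Function.update_of_ne hxw] at hlt
      exact ⟨x, hx, hlt, ih hxw (hlt.trans hs) hd⟩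

variable [Fintype V]

lemma play_eq (G : SimpleGraph V) (σ : V → Strategy V) (s : V → Bool) (T ω : V → unitInterval)
    (w : V) :
    play G σ s T ω w = decide (ω w < σ w (s w, observed G T (play G σ s T ω) w)) := by
  rw [play]
  simp only [dite_eq_ite]
  rfl

/-- The default value at depth `0` is consulted only at the end of a chain of `n` observations, and
such a chain has decreasing arrival times. -/
lemma playN_eq_play {G : SimpleGraph V} {σ : V → Strategy V} {s : V → Bool}
    {T ω : V → unitInterval} {n : ℕ} {w : V} (h : ¬ Descends G T n w) :
    playN G σ s T ω n w = play G σ s T ω w := by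
  induction n generalizing w with
  | zero => exact absurd trivial h
  | succ n ih =>
    rw [play_eq, playN, observed_congr (fun _ => Iff.rfl)]
    intro u hu hlt
    exact ih fun hd => h ⟨u, hu, hlt, hd⟩

open Classical in
lemma Descends.le_card {G : SimpleGraph V} {T : V → unitInterval} {n : ℕ} {w : V}
    (h : Descends G T n w) : n ≤ (Finset.univ.filter fun x => T x < T w).card := by
  induction n generalizing w with
  | zero => exact Nat.zero_le _
  | succ n ih =>
    obtain ⟨u, -, hlt, hd⟩ := h
    refine (Nat.succ_le_succ (ih hd)).trans (Finset.card_lt_card ?_)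
    refine (Finset.ssubset_iff_of_subset ?_).2 ⟨u, by simpa using hlt, by simp⟩
    intro x hx
    simp only [Finset.mem_filter, Finset.mem_univ, true_and] at hx ⊢
    exact hx.trans hlt

lemma not_descends_card (G : SimpleGraph V) (T : V → unitInterval) (w : V) :
    ¬ Descends G T (Fintype.card V) w := by
  classical
  intro h
  refine absurd h.le_card (not_le.2 (Finset.card_lt_card ?_))
  exact (Finset.ssubset_iff_of_subset (Finset.subset_univ _)).2 ⟨w, Finset.mem_univ _, by simp⟩

/-- Replaces the well-founded recursion by ordinary induction on a fixed depth; comparison of plays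
and measurability both rest on it. -/
lemma play_eq_playN (G : SimpleGraph V) (σ : V → Strategy V) (s : V → Bool)
    (T ω : V → unitInterval) :
    play G σ s T ω = playN G σ s T ω (Fintype.card V) :=
  funext fun _ => (playN_eq_play (not_descends_card G T _)).symm

/-- Two plays agree on a set of agents that is closed under observation and on which the
strategies and the observed friends agree. -/
lemma play_congr {G G' : SimpleGraph V} {σ σ' : V → Strategy V} {s s' : V → Bool}
    {T T' ω ω' : V → unitInterval} (P : V → Prop)
    (hσ : ∀ w, P w → σ w = σ' w) (hs : ∀ w, P w → s w = s' w) (hω : ∀ w, P w → ω w = ω' w)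
    (hG : ∀ w, P w → ∀ u, (G.Adj w u ∧ T u < T w) ↔ (G'.Adj w u ∧ T' u < T' w))
    (hP : ∀ w, P w → ∀ u, G.Adj w u → T u < T w → P u) {w : V} (hw : P w) :
    play G σ s T ω w = play G' σ' s' T' ω' w := by
  rw [play_eq_playN, play_eq_playN]
  generalize Fintype.card V = n
  induction n generalizing w with
  | zero => rfl
  | succ n ih =>
    rw [playN, playN, hσ w hw, hs w hw, hω w hw,
      observed_congr (hG w hw) fun u hu hlt => ih (hP w hw u hu hlt)]

/-- Whoever arrives before `v` plays as if `v` were isolated. -/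
lemma play_eq_play_cut {G : SimpleGraph V} {σ : V → Strategy V} {s : V → Bool}
    {T ω : V → unitInterval} {v w : V} (hw : w ≠ v) (hT : T w ≤ T v) :
    play G σ s T ω w = play (cut G v) σ s T ω w := by
  refine play_congr (fun x => x ≠ v ∧ T x ≤ T v) (fun _ _ => rfl) (fun _ _ => rfl)
    (fun _ _ => rfl) ?_ ?_ ⟨hw, hT⟩
  · rintro x ⟨hx, hxT⟩ u
    refine ⟨fun h => ⟨⟨h.1, hx, ?_⟩, h.2⟩, fun h => ⟨h.1.1, h.2⟩⟩
    rintro rfl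
    exact absurd (h.2.trans_le hxT) (lt_irrefl _)
  · rintro x ⟨hx, hxT⟩ u _ hlt
    refine ⟨?_, (hlt.trans_le hxT).le⟩
    rintro rfl
    exact absurd (hlt.trans_le hxT) (lt_irrefl _)

/-- The strategy of an agent does not affect those who arrive before him. -/
lemma play_update_of_lt [DecidableEq V] {G : SimpleGraph V} {σ : V → Strategy V} {s : V → Bool}
    {T ω : V → unitInterval} {v w : V} (τ : Strategy V) (hT : T w < T v) :
    play G (Function.update σ v τ) s T ω w = play G σ s T ω w := by
  refine play_congr (fun x => T x < T v) ?_ (fun _ _ => rfl) (fun _ _ => rfl)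
    (fun _ _ _ => Iff.rfl) (fun x hx u _ hlt => hlt.trans hx) hT
  rintro x hx
  exact Function.update_of_ne (by rintro rfl; exact lt_irrefl _ hx) _ _

lemma play_update_self [DecidableEq V] (G : SimpleGraph V) (σ : V → Strategy V) (s : V → Bool)
    (T ω : V → unitInterval) (v : V) (τ : Strategy V) :
    play G (Function.update σ v τ) s T ω v =
      decide (ω v < τ (s v, observed G T (play G σ s T ω) v)) := by
  rw [play_eq, Function.update_self,
    observed_congr (fun _ => Iff.rfl) fun u _ hlt => play_update_of_lt τ hlt]

/-- In the cut network nobody observes `v`, so his arrival time can be integrated out separately. -/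
lemma play_cut_congr {G : SimpleGraph V} {σ : V → Strategy V} {s s' : V → Bool}
    {T T' ω ω' : V → unitInterval} {v w : V} (hw : w ≠ v) (hs : ∀ x ≠ v, s x = s' x)
    (hT : ∀ x ≠ v, T x = T' x) (hω : ∀ x ≠ v, ω x = ω' x) :
    play (cut G v) σ s T ω w = play (cut G v) σ s' T' ω' w := by
  refine play_congr (fun x => x ≠ v) (fun _ _ => rfl) hs hω ?_
    (fun _ _ _ (h : (cut G v).Adj _ _) _ => h.2.2) hw
  intro x hx u
  refine and_congr_right fun h => ?_
  rw [hT x hx, hT u h.2.2]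

lemma nbhd_subset_of_adj {W : Type*} {H : SimpleGraph W} {n : ℕ} {w u : W} (h : H.Adj w u) :
    nbhd H n u ⊆ nbhd H (n + 1) w := by
  intro x hx
  have h1 : H.edist w u = 1 := SimpleGraph.edist_eq_one_iff_adj.2 h
  have h2 : H.edist u x ≤ n := hx
  calc H.edist w x ≤ H.edist w u + H.edist u x := SimpleGraph.edist_triangle
    _ ≤ 1 + n := by rw [h1]; gcongr
    _ = ((n + 1 : ℕ) : ℕ∞) := by push_cast; ring

lemma self_mem_nbhd {W : Type*} (H : SimpleGraph W) (n : ℕ) (w : W) : w ∈ nbhd H n w := by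
  simp [nbhd]

omit [Fintype V] in
/-- The truncated play of an agent is determined by what happens in his neighborhood. -/
lemma playN_cut_congr {G : SimpleGraph V} {σ : V → Strategy V} {s s' : V → Bool}
    {T T' ω ω' : V → unitInterval} {v : V} {n : ℕ} {w : {w : V // w ≠ v}}
    (hs : ∀ x ∈ nbhd (without G v) n w, s x = s' x)
    (hT : ∀ x ∈ nbhd (without G v) n w, T x = T' x)
    (hω : ∀ x ∈ nbhd (without G v) n w, ω x = ω' x) :
    playN (cut G v) σ s T ω n w = playN (cut G v) σ s' T' ω' n w := by
  induction n generalizing w with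
  | zero => rfl
  | succ n ih =>
    have hmem := self_mem_nbhd (without G v) (n + 1) w
    have hsub : ∀ u : V, (hu : (cut G v).Adj w u) →
        nbhd (without G v) n ⟨u, hu.2.2⟩ ⊆ nbhd (without G v) (n + 1) w :=
      fun u hu => nbhd_subset_of_adj (by simpa using hu.1)
    rw [playN, playN, hs w hmem, hω w hmem, observed_congr]
    · intro u
      refine and_congr_right fun h => ?_
      rw [hT w hmem, hT ⟨u, h.2.2⟩ (hsub u h (self_mem_nbhd _ _ _))]
    · intro u hu _
      exact ih (w := ⟨u, hu.2.2⟩) (fun x hx => hs x (hsub u hu hx))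
        (fun x hx => hT x (hsub u hu hx)) (fun x hx => hω x (hsub u hu hx))

lemma measurable_decide_lt_strategy {α : Type*} [MeasurableSpace α] (G : SimpleGraph V)
    (τ : Strategy V) (w : V) {b : α → Bool} {T : α → V → unitInterval} {ω : α → unitInterval}
    {a : α → V → Bool} (hb : Measurable b) (hT : ∀ u, Measurable fun z => T z u)
    (hω : Measurable ω) (ha : ∀ u, Measurable fun z => a z u) :
    Measurable fun z => decide (ω z < τ (b z, observed G (T z) (a z) w)) := by
  classical
  let _ : MeasurableSpace (Option Bool) := ⊤
  have _ : DiscreteMeasurableSpace (Option Bool) := ⟨fun _ => trivial⟩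
  have ho : Measurable fun z => observed G (T z) (a z) w := by
    refine measurable_pi_lambda _ fun u => ?_
    by_cases h : G.Adj w u
    · simp only [observed, h, true_and]
      refine Measurable.ite (measurableSet_lt (hT u) (hT w)) ?_ measurable_const
      exact (Measurable.of_discrete (f := (some : Bool → Option Bool))).comp (ha u)
    · simp only [observed, h, false_and, if_false]
      exact measurable_const
  have hτ : Measurable τ := Measurable.of_discrete
  exact measurable_to_bool (by
    simpa [Set.preimage, measurableSet_setOfPred] using
      measurableSet_lt hω (hτ.comp (hb.prodMk ho)))

lemma measurable_playN {α : Type*} [MeasurableSpace α] (G : SimpleGraph V) (σ : V → Strategy V)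
    {s : α → V → Bool} {T ω : α → V → unitInterval} (hs : ∀ u, Measurable fun z => s z u)
    (hT : ∀ u, Measurable fun z => T z u) (hω : ∀ u, Measurable fun z => ω z u) (n : ℕ) (w : V) :
    Measurable fun z => playN G σ (s z) (T z) (ω z) n w := by
  induction n generalizing w with
  | zero => exact measurable_const
  | succ n ih => exact measurable_decide_lt_strategy G (σ w) w (hs w) hT (hω w) ih

lemma measurable_play {α : Type*} [MeasurableSpace α] (G : SimpleGraph V) (σ : V → Strategy V)
    {s : α → V → Bool} {T ω : α → V → unitInterval} (hs : ∀ u, Measurable fun z => s z u)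
    (hT : ∀ u, Measurable fun z => T z u) (hω : ∀ u, Measurable fun z => ω z u) (w : V) :
    Measurable fun z => play G σ (s z) (T z) (ω z) w := by
  simp only [play_eq_playN]
  exact measurable_playN G σ hs hT hω _ w

lemma measurableSet_descends (G : SimpleGraph V) (n : ℕ) (w : V) :
    MeasurableSet {T : V → unitInterval | Descends G T n w} := by
  induction n generalizing w with
  | zero => simp [Descends]
  | succ n ih =>
    have h : {T : V → unitInterval | Descends G T (n + 1) w} =
        ⋃ u, ⋃ _ : G.Adj w u, {T | T u < T w} ∩ {T | Descends G T n u} := by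
      ext T; simp [Descends, and_left_comm]
    rw [h]
    exact MeasurableSet.iUnion fun u => MeasurableSet.iUnion fun _ =>
      (measurableSet_lt (measurable_pi_apply u) (measurable_pi_apply w)).inter (ih u)

end Dynamics

/-! ### Resampling one coordinate of a product measure. -/

section Resampling

variable {ι X : Type*} [Fintype ι] [DecidableEq ι] [MeasurableSpace X]

/-- Replacing one coordinate of a product measure by an independent copy preserves the measure. -/
lemma measurePreserving_update (μ : ι → Measure X) [∀ i, IsProbabilityMeasure (μ i)] (i : ι) :
    MeasurePreserving (fun q : X × (ι → X) => Function.update q.2 i q.1)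
      ((μ i).prod (Measure.pi μ)) (Measure.pi μ) := by
  have hmeas : Measurable fun q : X × (ι → X) => Function.update q.2 i q.1 := by
    refine measurable_pi_lambda _ fun j => ?_
    by_cases h : j = i
    · subst h; simpa using measurable_fst
    · simp only [Function.update_of_ne h]
      exact (measurable_pi_apply j).comp measurable_snd
  refine ⟨hmeas, (Measure.pi_eq fun A hA => ?_).symm⟩
  rw [Measure.map_apply hmeas (MeasurableSet.univ_pi hA)]
  have h : (fun q : X × (ι → X) => Function.update q.2 i q.1) ⁻¹' Set.univ.pi A =
      A i ×ˢ Set.univ.pi (Function.update A i Set.univ) := by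
    ext q
    simp only [Set.mem_preimage, Set.mem_pi, Set.mem_univ, true_imp_iff, Set.mem_prod]
    constructor
    · refine fun hq => ⟨by simpa using hq i, fun j => ?_⟩
      by_cases hj : j = i
      · subst hj; simp
      · simpa [Function.update_of_ne hj] using hq j
    · rintro ⟨hi, hq⟩ j
      by_cases hj : j = i
      · subst hj; simpa using hi
      · simpa [Function.update_of_ne hj] using hq j
  rw [h, Measure.prod_prod, Measure.pi_pi, ← Finset.mul_prod_erase _ _ (Finset.mem_univ i),
    ← Finset.mul_prod_erase _ (fun j => μ j (A j)) (Finset.mem_univ i)]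
  simp only [Function.update_self, measure_univ, one_mul]
  congr 1
  refine Finset.prod_congr rfl fun j hj => ?_
  rw [Function.update_of_ne (Finset.ne_of_mem_erase hj)]

lemma integral_resample (μ : ι → Measure X) [∀ i, IsProbabilityMeasure (μ i)] (i : ι)
    {F : (ι → X) → ℝ} (hF : Integrable F (Measure.pi μ)) :
    ∫ T, F T ∂Measure.pi μ = ∫ x, ∫ T, F (Function.update T i x) ∂Measure.pi μ ∂μ i := by
  have h := measurePreserving_update μ i
  have h1 := integral_map h.measurable.aemeasurable (f := F) (by rw [h.map_eq]; exact hF.1)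
  rw [h.map_eq] at h1
  rw [h1]
  exact integral_prod _ (h.integrable_comp_of_integrable hF)

lemma measureReal_resample (μ : ι → Measure X) [∀ i, IsProbabilityMeasure (μ i)] (i : ι)
    {E : Set (ι → X)} (hE : MeasurableSet E) :
    (Measure.pi μ).real E =
      ∫ x, (Measure.pi μ).real {T | Function.update T i x ∈ E} ∂μ i := by
  have h := integral_resample μ i (F := E.indicator 1) ((integrable_const 1).indicator hE)
  rw [integral_indicator_one hE] at h
  rw [h]
  refine integral_congr_ae (Filter.Eventually.of_forall fun x => ?_)
  have hm : Measurable fun T : ι → X => Function.update T i x := measurable_update_left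
  exact integral_indicator_one (hm hE)

end Resampling

/-! ### Integrals over the unit interval as interval integrals. -/

section UnitIntervalIntegrals

lemma integral_unitInterval (g : ℝ → ℝ) :
    ∫ s : unitInterval, g s = ∫ x in (0 : ℝ)..1, g x := by
  rw [unitInterval.measurePreserving_coe.integral_comp unitInterval.measurableEmbedding_coe,
    intervalIntegral.integral_of_le zero_le_one, integral_Icc_eq_integral_Ioc]

lemma integral_unitInterval_lt (g : ℝ → ℝ) (t : unitInterval) :
    ∫ s : unitInterval, (if s < t then g s else 0) = ∫ x in (0 : ℝ)..t, g x := by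
  have h := integral_unitInterval ((Set.Iio (t : ℝ)).indicator g)
  have h0 : (0 : ℝ) ≤ t := t.2.1
  have h1 : (t : ℝ) ≤ 1 := t.2.2
  have hset : Set.Icc (0 : ℝ) 1 ∩ Set.Iio (t : ℝ) = Set.Ico 0 (t : ℝ) := by
    ext x
    simp only [Set.mem_inter_iff, Set.mem_Icc, Set.mem_Iio, Set.mem_Ico]
    exact ⟨fun hx => ⟨hx.1.1, hx.2⟩, fun hx => ⟨⟨hx.1, (hx.2.trans_le h1).le⟩, hx.2⟩⟩
  rw [intervalIntegral.integral_of_le zero_le_one, ← integral_Icc_eq_integral_Ioc,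
    setIntegral_indicator measurableSet_Iio, hset, integral_Ico_eq_integral_Ioo,
    ← integral_Ioc_eq_integral_Ioo, ← intervalIntegral.integral_of_le h0] at h
  rw [← h]
  refine integral_congr_ae (Filter.Eventually.of_forall fun s => ?_)
  simp only [Set.indicator, Set.mem_Iio, Subtype.coe_lt_coe]

end UnitIntervalIntegrals

/-! ### Probability of long decreasing paths. -/

section Descends

variable {V : Type*} [Fintype V]

open Classical in
/-- Long paths of decreasing arrival times are unlikely. -/
lemma measureReal_descends_le (G : SimpleGraph V) (v : V) (D n : ℕ) (w : {w : V // w ≠ v})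
    (hD : ∀ x ∈ nbhd (without G v) n w, (without G v).degree x ≤ D) (t : unitInterval) :
    (volume : Measure (V → unitInterval)).real
        {T | T w < t ∧ Descends (cut G v) T n w} ≤
      (D : ℝ) ^ n * ((t : ℝ) ^ (n + 1) / (n + 1).factorial) := by
  have hmeas : ∀ n (w : V) (t : unitInterval),
      MeasurableSet {T : V → unitInterval | T w < t ∧ Descends (cut G v) T n w} :=
    fun n w t => (measurableSet_lt (measurable_pi_apply w) measurable_const).inter
      (measurableSet_descends _ n w)
  induction n generalizing w t with
  | zero =>
    rw [volume_pi, measureReal_resample _ (w : V) (hmeas 0 w t)]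
    have h : ∀ s : unitInterval, (Measure.pi fun _ : V => (volume : Measure unitInterval)).real
        {T | Function.update T (w : V) s ∈ {T | T w < t ∧ Descends (cut G v) T 0 w}} =
          if s < t then (1 : ℝ) else 0 := by
      intro s
      by_cases hs : s < t <;> simp [hs, Descends]
    simp only [h]
    rw [integral_unitInterval_lt (fun _ => 1)]
    simp
  | succ n ih =>
    -- Condition on `T w = s`. The path must continue from one of at most `D` neighbors arriving
    -- before `s`; the induction hypothesis with threshold `s` is then integrated over `s < t`.
    rw [volume_pi, measureReal_resample _ (w : V) (hmeas _ w t)]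
    set C : ℝ := (D : ℝ) ^ (n + 1) / (n + 1).factorial with hC
    have hC0 : 0 ≤ C := by positivity
    have h : ∀ s : unitInterval, (Measure.pi fun _ : V => (volume : Measure unitInterval)).real
        {T | Function.update T (w : V) s ∈ {T | T w < t ∧ Descends (cut G v) T (n + 1) w}} ≤
          if s < t then C * (s : ℝ) ^ (n + 1) else 0 := by
      intro s
      by_cases hs : s < t
      · rw [if_pos hs]
        have hsub : {T : V → unitInterval | Function.update T (w : V) s ∈
              {T | T w < t ∧ Descends (cut G v) T (n + 1) w}} ⊆
            ⋃ u ∈ (without G v).neighborFinset w,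
              {T | T u < s ∧ Descends (cut G v) T n u} := by
          rintro T ⟨-, u, hu, hlt, hd⟩
          have huw : u ≠ w := hu.1.ne'
          rw [Function.update_of_ne huw, Function.update_self] at hlt
          simp only [Set.mem_iUnion]
          exact ⟨⟨u, hu.2.2⟩, by simpa using hu.1, hlt, descends_update huw hlt hd⟩
        refine (measureReal_mono hsub (measure_ne_top _ _)).trans ((measureReal_biUnion_finset_le _ _).trans ?_)
        have hle : ∀ u ∈ (without G v).neighborFinset w,
            (Measure.pi fun _ : V => (volume : Measure unitInterval)).real
              {T | T u < s ∧ Descends (cut G v) T n u} ≤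
            (D : ℝ) ^ n * ((s : ℝ) ^ (n + 1) / (n + 1).factorial) := by
          intro u hu
          refine ih u (fun x hx => hD x (nbhd_subset_of_adj ?_ hx)) s
          simpa using hu
        refine (Finset.sum_le_card_nsmul _ _ _ hle).trans ?_
        rw [SimpleGraph.card_neighborFinset_eq_degree, nsmul_eq_mul]
        have hdeg : ((without G v).degree w : ℝ) ≤ D :=
          Nat.cast_le.2 (hD w (self_mem_nbhd _ _ _))
        have hs0 : (0 : ℝ) ≤ s := s.2.1
        calc _ ≤ (D : ℝ) * ((D : ℝ) ^ n * ((s : ℝ) ^ (n + 1) / (n + 1).factorial)) := by gcongr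
          _ = C * (s : ℝ) ^ (n + 1) := by rw [hC]; ring
      · simp [hs]
    have hint : Integrable (fun s : unitInterval =>
        if s < t then C * (s : ℝ) ^ (n + 1) else 0) := by
      refine Integrable.of_bound (C := C) ?_ (Filter.Eventually.of_forall fun s => ?_)
      · refine (Measurable.ite measurableSet_Iio ?_ measurable_const).aestronglyMeasurable
        fun_prop
      · have hs0 : (0 : ℝ) ≤ s := s.2.1
        have hs1 : (s : ℝ) ^ (n + 1) ≤ 1 := pow_le_one₀ hs0 s.2.2
        split_ifs
        · rw [Real.norm_of_nonneg (by positivity)]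
          exact mul_le_of_le_one_right hC0 hs1
        · simpa using hC0
    refine (integral_mono_of_nonneg (Filter.Eventually.of_forall fun _ => measureReal_nonneg)
      hint (Filter.Eventually.of_forall h)).trans ?_
    rw [integral_unitInterval_lt (fun x => C * x ^ (n + 1)), intervalIntegral.integral_const_mul,
      integral_pow, hC]
    refine le_of_eq ?_
    rw [Nat.factorial_succ (n + 1)]
    push_cast
    have : ((n + 1).factorial : ℝ) ≠ 0 := by positivity
    field_simp
    ring

end Descends

/-! ### Binomial counts of arrived friends and the reweighting error. -/

section Binomial

lemma sum_bernstein (n : ℕ) (s : unitInterval) :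
    ∑ k ∈ Finset.range (n + 1), bernstein n k s = 1 := by
  rw [Finset.sum_range (fun k => bernstein n k s)]
  exact bernstein.probability n s

lemma sum_sq_mul_bernstein {n : ℕ} (hn : n ≠ 0) (s : unitInterval) :
    ∑ k ∈ Finset.range (n + 1), ((s : ℝ) - k / n) ^ 2 * bernstein n k s =
      (s : ℝ) * (1 - s) / n := by
  rw [Finset.sum_range (fun k => ((s : ℝ) - k / n) ^ 2 * bernstein n k s)]
  exact bernstein.variance hn s

/-- Cauchy–Schwarz for the probability weights `bernstein n k s`, followed by the variance formula.
-/
lemma sum_bernstein_mul_abs_sub_le {n : ℕ} (hn : n ≠ 0) (s : unitInterval) :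
    ∑ k ∈ Finset.range (n + 1), bernstein n k s * |(s : ℝ) - k / n| ≤
      Real.sqrt ((s : ℝ) * (1 - s) / n) := by
  refine Real.le_sqrt_of_sq_le ?_
  have h := Finset.sum_mul_sq_le_sq_mul_sq (Finset.range (n + 1))
    (fun k => Real.sqrt (bernstein n k s))
    (fun k => Real.sqrt (bernstein n k s) * |(s : ℝ) - k / n|)
  have h1 : ∀ k : ℕ, Real.sqrt (bernstein n k s) * (Real.sqrt (bernstein n k s) *
      |(s : ℝ) - k / n|) = bernstein n k s * |(s : ℝ) - k / n| := fun k => by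
    rw [← mul_assoc, Real.mul_self_sqrt bernstein_nonneg]
  have h2 : ∀ k : ℕ, (Real.sqrt (bernstein n k s) * |(s : ℝ) - k / n|) ^ 2 =
      ((s : ℝ) - k / n) ^ 2 * bernstein n k s := fun k => by
    rw [mul_pow, Real.sq_sqrt bernstein_nonneg, sq_abs, mul_comm]
  simp only [h1, h2, Real.sq_sqrt bernstein_nonneg, sum_bernstein, sum_sq_mul_bernstein hn,
    one_mul] at h
  exact h

open Classical in
/-- The number of agents in a set that arrive before time `s` is binomially distributed. -/
lemma integral_card_lt {V : Type*} [Fintype V] (N : Finset V) (s : unitInterval) (φ : ℕ → ℝ) :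
    ∫ T : V → unitInterval, φ (N.filter fun j => T j < s).card =
      ∑ k ∈ Finset.range (N.card + 1), bernstein N.card k s * φ k := by
  -- The box on which exactly the members `F` of `N` arrive before `s`; coordinates outside `N` are
  -- free. These boxes partition the space as `F` runs through the subsets of `N`.
  set A : Finset V → V → Set unitInterval := fun F j =>
    if j ∈ N then (if j ∈ F then Set.Iio s else Set.Ici s) else Set.univ with hA
  have hAm : ∀ F, MeasurableSet (Set.univ.pi (A F)) := fun F =>
    MeasurableSet.univ_pi fun j => by
      simp only [hA]
      split_ifs
      · exact measurableSet_Iio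
      · exact measurableSet_Ici
      · exact MeasurableSet.univ
  have hmem : ∀ F ∈ N.powerset, ∀ T : V → unitInterval,
      T ∈ Set.univ.pi (A F) ↔ (N.filter fun j => T j < s) = F := by
    intro F hF T
    rw [Finset.mem_powerset] at hF
    simp only [Set.mem_univ_pi, hA]
    constructor
    · intro h
      ext j
      have hj := h j
      by_cases hN : j ∈ N
      · by_cases hjF : j ∈ F
        · simp only [hN, hjF, if_true, Set.mem_Iio] at hj
          simp [hN, hjF, hj]
        · simp only [hN, hjF, if_true, if_false, Set.mem_Ici] at hj
          simp [hjF, hj]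
      · simp only [Finset.mem_filter, hN, false_and, false_iff]
        exact fun h' => hN (hF h')
    · rintro rfl j
      by_cases hN : j ∈ N
      · by_cases hj : T j < s
        · simp [hN, hj]
        · simp [hN, hj, not_lt.1 hj]
      · simp [hN]
  have hsum : ∀ T : V → unitInterval, φ (N.filter fun j => T j < s).card =
      ∑ F ∈ N.powerset, (Set.univ.pi (A F)).indicator (fun _ => φ F.card) T := by
    intro T
    rw [Finset.sum_eq_single_of_mem (N.filter fun j => T j < s)
      (Finset.mem_powerset.2 (Finset.filter_subset _ _))]
    · rw [Set.indicator_of_mem]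
      exact (hmem _ (Finset.mem_powerset.2 (Finset.filter_subset _ _)) T).2 rfl
    · intro F hF hne
      rw [Set.indicator_of_notMem]
      exact fun h => hne ((hmem F hF T).1 h).symm
  simp only [hsum]
  rw [integral_finsetSum _ fun F _ => (integrable_const _).indicator (hAm F)]
  have hvol : ∀ F ∈ N.powerset, ∫ T : V → unitInterval,
      (Set.univ.pi (A F)).indicator (fun _ => φ F.card) T =
        (s : ℝ) ^ F.card * (1 - (s : ℝ)) ^ (N.card - F.card) * φ F.card := by
    intro F hF
    rw [Finset.mem_powerset] at hF
    rw [integral_indicator_const _ (hAm F), smul_eq_mul, measureReal_def, volume_pi,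
      Measure.pi_pi, ENNReal.toReal_prod]
    congr 1
    have h1 : ∀ j, (volume (A F j)).toReal =
        if j ∈ N then (if j ∈ F then (s : ℝ) else 1 - s) else 1 := by
      intro j
      have hs0 : (0 : ℝ) ≤ s := s.2.1
      have hs1 : (0 : ℝ) ≤ 1 - s := sub_nonneg.2 s.2.2
      simp only [hA]
      split_ifs
      · rw [unitInterval.volume_Iio, ENNReal.toReal_ofReal hs0]
      · rw [unitInterval.volume_Ici, ENNReal.toReal_ofReal hs1]
      · simp
    simp only [h1]
    rw [Finset.prod_ite_mem, Finset.univ_inter, Finset.prod_ite, Finset.prod_const,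
      Finset.prod_const]
    congr 2
    · congr 1
      ext j
      simp only [Finset.mem_filter]
      exact ⟨fun h => h.2, fun h => ⟨hF h, h⟩⟩
    · rw [← Finset.card_sdiff_of_subset hF]
      congr 1
      ext j
      simp
  rw [Finset.sum_congr rfl hvol,
    Finset.sum_powerset_apply_card
      (fun k => (s : ℝ) ^ k * (1 - (s : ℝ)) ^ (N.card - k) * φ k)]
  refine Finset.sum_congr rfl fun k _ => ?_
  rw [bernstein_apply, nsmul_eq_mul]
  ring

/-- The weight that an agent with `k` arrived friends out of `n` attaches to his information set:
it makes up for the friend `v` not having arrived, and cuts off at arrival time `t`. -/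
noncomputable def friendWeight (n : ℕ) (t : unitInterval) (k : ℕ) : ℝ :=
  if (k : ℝ) ≤ n * (t : ℝ) then ((n : ℝ) + 1) / (n + 1 - k) else 0

lemma friendWeight_nonneg {n k : ℕ} (hk : k ≤ n) (t : unitInterval) : 0 ≤ friendWeight n t k := by
  have : (k : ℝ) ≤ n := Nat.cast_le.2 hk
  unfold friendWeight
  split_ifs
  · exact div_nonneg (by positivity) (by linarith)
  · exact le_rfl

lemma friendWeight_le {n k : ℕ} (hk : k ≤ n) (t : unitInterval) : friendWeight n t k ≤ n + 1 := by
  have : (k : ℝ) ≤ n := Nat.cast_le.2 hk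
  unfold friendWeight
  split_ifs
  · exact div_le_self (by positivity) (by linarith)
  · positivity

/-- When the two indicators differ, `t` lies between `s` and `k / n`, so `|s - t| ≤ |s - k / n|` and
the difference is at most the quotient `(1 + 4n(s - k/n)²) / (1 + 4n(s - t)²)`. The variance formula
turns the mean of the numerator into `1 + 4s(1 - s) ≤ 2`. -/
lemma sum_bernstein_mul_cutoff_le {n : ℕ} (hn : n ≠ 0) (s t : unitInterval) :
    ∑ k ∈ Finset.range (n + 1), bernstein n k s *
        |(if s < t then (1 : ℝ) else 0) - (if (k : ℝ) ≤ n * (t : ℝ) then 1 else 0)| ≤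
      2 * (1 + (2 * Real.sqrt n * s - 2 * Real.sqrt n * t) ^ 2)⁻¹ := by
  have hn0 : (0 : ℝ) < n := by positivity
  have hs0 : (0 : ℝ) ≤ s := s.2.1
  have hs1 : (s : ℝ) ≤ 1 := s.2.2
  have hsq : (2 * Real.sqrt n * s - 2 * Real.sqrt n * t) ^ 2 = 4 * n * ((s : ℝ) - t) ^ 2 := by
    rw [← mul_sub, mul_pow, mul_pow, Real.sq_sqrt hn0.le]; ring
  rw [hsq]
  set B : ℝ := 1 + 4 * n * ((s : ℝ) - t) ^ 2 with hB
  have hB0 : 0 < B := by positivity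
  have hterm : ∀ k : ℕ, |(if s < t then (1 : ℝ) else 0) -
      (if (k : ℝ) ≤ n * (t : ℝ) then 1 else 0)| ≤ (1 + 4 * n * ((s : ℝ) - k / n) ^ 2) * B⁻¹ := by
    intro k
    have key : ((s : ℝ) - t) ^ 2 ≤ ((s : ℝ) - k / n) ^ 2 →
        (1 : ℝ) ≤ (1 + 4 * n * ((s : ℝ) - k / n) ^ 2) * B⁻¹ := by
      intro h
      rw [← div_eq_mul_inv, one_le_div hB0, hB]
      gcongr
    by_cases h1 : s < t <;> by_cases h2 : (k : ℝ) ≤ n * (t : ℝ)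
    · simp only [h1, h2, if_true, sub_self, abs_zero]; positivity
    · simp only [h1, h2, if_true, if_false, sub_zero, abs_one]
      apply key
      have h3 : (t : ℝ) < k / n := by rw [lt_div_iff₀ hn0]; linarith
      have h4 : (s : ℝ) < t := h1
      nlinarith
    · simp only [h1, h2, if_true, if_false, zero_sub, abs_neg, abs_one]
      apply key
      have h3 : (k : ℝ) / n ≤ t := by rw [div_le_iff₀ hn0]; linarith
      have h4 : (t : ℝ) ≤ s := not_lt.1 h1
      nlinarith
    · simp only [h1, h2, if_false, sub_self, abs_zero]; positivity
  calc _ ≤ ∑ k ∈ Finset.range (n + 1), bernstein n k s *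
        ((1 + 4 * n * ((s : ℝ) - k / n) ^ 2) * B⁻¹) := by
        gcongr with k _
        exact hterm k
    _ = (∑ k ∈ Finset.range (n + 1), bernstein n k s +
          4 * n * ∑ k ∈ Finset.range (n + 1), ((s : ℝ) - k / n) ^ 2 * bernstein n k s) * B⁻¹ := by
        rw [Finset.mul_sum, ← Finset.sum_add_distrib, Finset.sum_mul]
        exact Finset.sum_congr rfl fun k _ => by ring
    _ = (1 + 4 * ((s : ℝ) * (1 - s))) * B⁻¹ := by
        rw [sum_bernstein, sum_sq_mul_bernstein hn]; field_simp
    _ ≤ 2 * B⁻¹ := by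
        gcongr
        nlinarith [sq_nonneg (2 * (s : ℝ) - 1)]

/-- The factor `(n + 1) / (n + 1 - k) * (1 - s)` turns `bernstein n k s` into `bernstein (n + 1) k
s`. The difference of the two is `bernstein (n + 1) k s * (s - k / (n + 1)) / (1 - s)`, up to sign,
so the mean absolute deviation for `n + 1` trials applies. -/
lemma sum_bernstein_mul_ratio_le (n : ℕ) {s : unitInterval} (hs : (s : ℝ) < 1) :
    ∑ k ∈ Finset.range (n + 1), bernstein n k s *
        |1 - ((n : ℝ) + 1) / (n + 1 - k) * (1 - s)| ≤
      (Real.sqrt (n + 1))⁻¹ * (1 - (s : ℝ)) ^ (-(1 / 2) : ℝ) := by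
  have hs0 : (0 : ℝ) ≤ s := s.2.1
  have hs1 : (0 : ℝ) < 1 - s := sub_pos.2 hs
  have hterm : ∀ k ∈ Finset.range (n + 1), bernstein n k s *
      |1 - ((n : ℝ) + 1) / (n + 1 - k) * (1 - s)| =
      (1 - (s : ℝ))⁻¹ * (bernstein (n + 1) k s * |(s : ℝ) - k / (n + 1 : ℕ)|) := by
    intro k hk
    have hkn : k ≤ n := Nat.lt_succ_iff.1 (Finset.mem_range.1 hk)
    have hkn' : (k : ℝ) ≤ n := Nat.cast_le.2 hkn
    have hpos : (0 : ℝ) < n + 1 - k := by linarith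
    have hch : (n.choose k : ℝ) * (n + 1) = ((n + 1).choose k : ℝ) * (n + 1 - k) := by
      have h := Nat.choose_mul_succ_eq n k
      have h' : ((n + 1 - k : ℕ) : ℝ) = n + 1 - k := by
        rw [Nat.cast_sub (by omega)]; push_cast; ring
      rw [← h']
      exact_mod_cast h
    have hb : bernstein n k s =
        (1 - (s : ℝ))⁻¹ * (bernstein (n + 1) k s * ((n + 1 - k) / (n + 1))) := by
      rw [bernstein_apply, bernstein_apply, show n + 1 - k = (n - k) + 1 by omega, pow_succ,
        eq_div_of_mul_eq (by positivity) hch]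
      field_simp
    have habs : (s : ℝ) - k / (n + 1 : ℕ) = ((n + 1 - k) / (n + 1)) *
        (1 - ((n : ℝ) + 1) / (n + 1 - k) * (1 - s)) := by
      push_cast
      field_simp
      ring
    rw [habs, abs_mul, abs_of_nonneg (div_nonneg hpos.le (by positivity)), hb]
    ring
  rw [Finset.sum_congr rfl hterm, ← Finset.mul_sum]
  have hle : ∑ k ∈ Finset.range (n + 1), bernstein (n + 1) k s * |(s : ℝ) - k / (n + 1 : ℕ)| ≤
      Real.sqrt ((s : ℝ) * (1 - s) / (n + 1 : ℕ)) := by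
    refine le_trans ?_ (sum_bernstein_mul_abs_sub_le n.succ_ne_zero s)
    refine Finset.sum_le_sum_of_subset_of_nonneg (Finset.range_mono (Nat.le_succ _)) ?_
    exact fun k _ _ => mul_nonneg bernstein_nonneg (abs_nonneg _)
  calc _ ≤ (1 - (s : ℝ))⁻¹ * Real.sqrt ((s : ℝ) * (1 - s) / (n + 1 : ℕ)) := by gcongr
    _ ≤ (1 - (s : ℝ))⁻¹ * Real.sqrt ((1 - s) / (n + 1 : ℕ)) := by
        gcongr
        exact mul_le_of_le_one_left hs1.le s.2.2
    _ = (Real.sqrt (n + 1))⁻¹ * (1 - (s : ℝ)) ^ (-(1 / 2) : ℝ) := by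
        rw [Real.sqrt_div hs1.le, Real.rpow_neg hs1.le, ← Real.sqrt_eq_rpow]
        push_cast
        have h1 : Real.sqrt (1 - (s : ℝ)) ≠ 0 := (Real.sqrt_pos.2 hs1).ne'
        have h2 : (1 - (s : ℝ))⁻¹ = (Real.sqrt (1 - s))⁻¹ * (Real.sqrt (1 - s))⁻¹ := by
          rw [← mul_inv, Real.mul_self_sqrt hs1.le]
        rw [h2]
        field_simp

/-- Triangle inequality through the indicator of `k ≤ n * t`; the error of the ratio matters only
where that indicator is `1`. -/
lemma sum_bernstein_mul_friendWeight_le {n : ℕ} (hn : n ≠ 0) {s : unitInterval}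
    (hs : (s : ℝ) < 1) (t : unitInterval) :
    ∑ k ∈ Finset.range (n + 1), bernstein n k s *
        |(if s < t then (1 : ℝ) else 0) - friendWeight n t k * (1 - s)| ≤
      2 * (1 + (2 * Real.sqrt n * s - 2 * Real.sqrt n * t) ^ 2)⁻¹ +
        (Real.sqrt (n + 1))⁻¹ * (1 - (s : ℝ)) ^ (-(1 / 2) : ℝ) := by
  refine le_trans ?_ (add_le_add (sum_bernstein_mul_cutoff_le hn s t)
    (sum_bernstein_mul_ratio_le n hs))
  rw [← Finset.sum_add_distrib]
  refine Finset.sum_le_sum fun k _ => ?_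
  rw [← mul_add]
  refine mul_le_mul_of_nonneg_left ?_ bernstein_nonneg
  unfold friendWeight
  split_ifs with h1 h2 h2
  · simp
  · simp
  · have h := abs_sub_le (0 : ℝ) 1 (((n : ℝ) + 1) / (n + 1 - k) * (1 - s))
    simpa using h
  · simp

/-- The first term integrates to a difference of arctangents, at most `2 * π / (2 * √n)`. The second
gives `2 / √(n + 1)`, since `(1 - s) ^ (-1/2)` has integral `2`. -/
lemma integral_friendWeight_error_bound {n : ℕ} (hn : n ≠ 0) (t : unitInterval) :
    Integrable (fun s : unitInterval =>
        2 * (1 + (2 * Real.sqrt n * s - 2 * Real.sqrt n * t) ^ 2)⁻¹ +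
          (Real.sqrt (n + 1))⁻¹ * (1 - (s : ℝ)) ^ (-(1 / 2) : ℝ)) ∧
      ∫ s : unitInterval, (2 * (1 + (2 * Real.sqrt n * s - 2 * Real.sqrt n * t) ^ 2)⁻¹ +
          (Real.sqrt (n + 1))⁻¹ * (1 - (s : ℝ)) ^ (-(1 / 2) : ℝ)) ≤
        (Real.pi + 2) / Real.sqrt n := by
  have hn0 : (0 : ℝ) < n := by positivity
  have hc : (0 : ℝ) < 2 * Real.sqrt n := by positivity
  set c : ℝ := 2 * Real.sqrt n with hc_def
  have hi1 : IntervalIntegrable (fun x : ℝ => 2 * (1 + (c * x - c * t) ^ 2)⁻¹) volume 0 1 := by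
    refine Continuous.intervalIntegrable ?_ _ _
    refine continuous_const.mul (Continuous.inv₀ (by fun_prop) fun x => ?_)
    positivity
  have hi2 : IntervalIntegrable (fun x : ℝ => (1 - x) ^ (-(1 / 2) : ℝ)) volume 0 1 := by
    have h := (intervalIntegral.intervalIntegrable_rpow' (a := 0) (b := 1)
      (r := (-(1 / 2) : ℝ)) (by norm_num)).comp_sub_left 1
    simpa using h.symm
  have hi := hi1.add (hi2.const_mul (Real.sqrt (n + 1))⁻¹)
  constructor
  · rw [intervalIntegrable_iff_integrableOn_Icc_of_le zero_le_one] at hi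
    exact (unitInterval.measurePreserving_coe.integrable_comp_emb
      unitInterval.measurableEmbedding_coe).2 hi
  · rw [integral_unitInterval (fun x => 2 * (1 + (c * x - c * t) ^ 2)⁻¹ +
      (Real.sqrt (n + 1))⁻¹ * (1 - x) ^ (-(1 / 2) : ℝ)),
      intervalIntegral.integral_add hi1 (hi2.const_mul _), intervalIntegral.integral_const_mul,
      intervalIntegral.integral_const_mul,
      intervalIntegral.integral_comp_mul_sub (fun x => (1 + x ^ 2)⁻¹) hc.ne',
      integral_inv_one_add_sq, intervalIntegral.integral_comp_sub_left
        (fun x => x ^ (-(1 / 2) : ℝ)), integral_rpow (Or.inl (by norm_num))]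
    have h1 : Real.arctan (c * 1 - c * t) - Real.arctan (c * 0 - c * t) ≤ Real.pi := by
      linarith [Real.arctan_lt_pi_div_two (c * 1 - c * t),
        Real.neg_pi_div_two_lt_arctan (c * 0 - c * t)]
    have h2 : ((1 - 0 : ℝ) ^ (-(1 / 2) + 1 : ℝ) - (1 - 1 : ℝ) ^ (-(1 / 2) + 1 : ℝ)) /
        (-(1 / 2) + 1 : ℝ) = 2 := by
      rw [sub_zero, sub_self, Real.one_rpow, Real.zero_rpow (by norm_num)]; norm_num
    have h3 : (Real.sqrt (n + 1))⁻¹ ≤ (Real.sqrt n)⁻¹ := by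
      gcongr; linarith
    rw [h2, smul_eq_mul]
    calc _ ≤ 2 * (c⁻¹ * Real.pi) + (Real.sqrt n)⁻¹ * 2 := by gcongr
      _ = (Real.pi + 2) / Real.sqrt n := by rw [hc_def]; field_simp

open Classical in
/-- Reweighting by the number of observed friends almost restores the event of arriving before
time `t`. -/
lemma integral_abs_friendWeight_le {V : Type*} [Fintype V] {N : Finset V} {u : V} (hu : u ∉ N)
    (hN : N.card ≠ 0) (t : unitInterval) :
    ∫ T : V → unitInterval, |(if T u < t then (1 : ℝ) else 0) -
        friendWeight N.card t (N.filter fun j => T j < T u).card * (1 - T u)| ≤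
      (Real.pi + 2) / Real.sqrt N.card := by
  obtain ⟨hint, hle⟩ := integral_friendWeight_error_bound hN t
  refine le_trans ?_ hle
  have hcard : Measurable fun T : V → unitInterval => (N.filter fun j => T j < T u).card := by
    simp only [Finset.card_filter]
    exact Finset.measurable_sum _ fun j _ => Measurable.ite
      (measurableSet_lt (measurable_pi_apply j) (measurable_pi_apply u)) measurable_const
      measurable_const
  have hF : Integrable fun T : V → unitInterval => |(if T u < t then (1 : ℝ) else 0) -
        friendWeight N.card t (N.filter fun j => T j < T u).card * (1 - T u)| := by
    refine Integrable.of_bound (C := 1 + (N.card + 1)) ?_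
      (Filter.Eventually.of_forall fun T => ?_)
    · refine Measurable.aestronglyMeasurable (Measurable.abs (Measurable.sub ?_ ?_))
      · exact Measurable.ite (measurableSet_lt (measurable_pi_apply u) measurable_const)
          measurable_const measurable_const
      · exact ((measurable_from_nat (f := friendWeight N.card t)).comp hcard).mul
          (measurable_const.sub (measurable_subtype_coe.comp (measurable_pi_apply u)))
    · have h0 : (0 : ℝ) ≤ T u := (T u).2.1
      have h1 : (T u : ℝ) ≤ 1 := (T u).2.2
      have hk := friendWeight_nonneg (Finset.card_filter_le N fun j => T j < T u) t
      have hk' := friendWeight_le (Finset.card_filter_le N fun j => T j < T u) t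
      rw [Real.norm_eq_abs, abs_abs]
      refine (abs_sub _ _).trans (add_le_add ?_ ?_)
      · split_ifs <;> simp
      · rw [abs_of_nonneg (mul_nonneg hk (by linarith))]
        exact (mul_le_of_le_one_right hk (by linarith)).trans hk'
  rw [volume_pi] at hF ⊢
  -- Condition on `T u = s`. As `u ∉ N`, the count of arrivals before `u` is then binomial with
  -- parameters `N.card` and `s`.
  rw [integral_resample _ u hF]
  have hinner : ∀ s : unitInterval, ∫ T : V → unitInterval,
      |(if Function.update T u s u < t then (1 : ℝ) else 0) -
        friendWeight N.card t (N.filter fun j => Function.update T u s j <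
          Function.update T u s u).card * (1 - Function.update T u s u)|
        ∂(Measure.pi fun _ : V => (volume : Measure unitInterval)) =
      ∑ k ∈ Finset.range (N.card + 1), bernstein N.card k s *
        |(if s < t then (1 : ℝ) else 0) - friendWeight N.card t k * (1 - s)| := by
    intro s
    rw [← integral_card_lt N s (fun k =>
      |(if s < t then (1 : ℝ) else 0) - friendWeight N.card t k * (1 - s)|), volume_pi]
    refine integral_congr_ae (Filter.Eventually.of_forall fun T => ?_)
    have hfil : (N.filter fun j => Function.update T u s j < Function.update T u s u) =
        N.filter fun j => T j < s := by
      refine Finset.filter_congr fun j hj => ?_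
      rw [Function.update_self, Function.update_of_ne (fun h : j = u => hu (h ▸ hj))]
    simp only [Function.update_self] at hfil ⊢
    rw [hfil]
  simp only [hinner]
  refine integral_mono_of_nonneg (Filter.Eventually.of_forall fun s => ?_) hint ?_
  · exact Finset.sum_nonneg fun k _ => mul_nonneg bernstein_nonneg (abs_nonneg _)
  -- The pointwise bound is available only for `s < 1`, where `1 - s` can be inverted.
  · have hne : ∀ᵐ s : unitInterval, s < 1 := by
      rw [ae_iff]
      have : {s : unitInterval | ¬ s < 1} = Set.Ici 1 := by ext; simp
      rw [this, unitInterval.volume_Ici]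
      simp
    filter_upwards [hne] with s hs
    exact sum_bernstein_mul_friendWeight_le hN hs t

end Binomial

/-! ### The randomness other than the state, scores, and integrating out `T v`. -/

section Noise

/-- Everything random except the state: correctness of signals, arrival times and randomization
devices. -/
abbrev Noise (V : Type*) := (V → Bool) × (V → unitInterval) × (V → unitInterval)

/-- The distribution of everything except the state. -/
noncomputable def noise (V : Type*) [Fintype V] (p : unitInterval) : Measure (Noise V) :=
  (Measure.pi fun _ : V => bernoulliMeasure true false p).prod
    ((volume : Measure (V → unitInterval)).prod (volume : Measure (V → unitInterval)))

/-- The signals in state `b`. -/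
def signalsIn {V : Type*} (b : Bool) (c : V → Bool) : V → Bool := fun w => if c w then b else !b

/-- The score `1` for a correct and `-1` for an incorrect action. -/
def score (a b : Bool) : ℝ := if a = b then 1 else -1

lemma abs_score (a b : Bool) : |score a b| = 1 := by
  unfold score; split_ifs <;> simp

lemma score_not (a b : Bool) : score (!a) (!b) = score a b := by
  cases a <;> cases b <;> simp [score]

lemma score_signalsIn {V : Type*} (b : Bool) (c : V → Bool) (w : V) :
    score (signalsIn b c w) b = score (c w) true := by
  cases h : c w <;> cases b <;> simp [score, signalsIn, h]

lemma integrable_of_abs_le {α : Type*} [MeasurableSpace α] {μ : Measure α} [IsFiniteMeasure μ]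
    {f : α → ℝ} (hf : Measurable f) {C : ℝ} (h : ∀ x, |f x| ≤ C) : Integrable f μ :=
  Integrable.of_bound hf.aestronglyMeasurable C (Filter.Eventually.of_forall h)

lemma abs_ite_mul_le {P : Prop} [Decidable P] {x C : ℝ} (h : |x| ≤ C) :
    |(if P then (1 : ℝ) else 0) * x| ≤ C := by
  split_ifs
  · simpa using h
  · simpa using (abs_nonneg x).trans h

variable {V : Type*} [Fintype V] (p : unitInterval)

instance : IsProbabilityMeasure (noise V p) := by unfold noise; infer_instance

lemma prior_eq : prior V p =
    (bernoulliMeasure true false (⟨1 / 2, by norm_num, by norm_num⟩ : unitInterval)).prod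
      (noise V p) := rfl

instance : IsProbabilityMeasure (prior V p) := by rw [prior_eq]; infer_instance

lemma integral_prior {f : Sample V → ℝ} (hf : Measurable f) {C : ℝ} (hC : ∀ x, |f x| ≤ C) :
    ∫ x, f x ∂prior V p =
      (∫ z, f (true, z) ∂noise V p + ∫ z, f (false, z) ∂noise V p) / 2 := by
  have hi : Integrable f (prior V p) := integrable_of_abs_le hf hC
  rw [prior_eq] at hi ⊢
  rw [integral_prod _ hi, integral_bernoulliMeasure]
  simp only [smul_eq_mul]
  norm_num
  ring

lemma measureReal_prior {E : Set (Sample V)} (hE : MeasurableSet E) :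
    (prior V p).real E =
      ((noise V p).real {z | (true, z) ∈ E} + (noise V p).real {z | (false, z) ∈ E}) / 2 := by
  have hm : ∀ b : Bool, MeasurableSet {z : Noise V | (b, z) ∈ E} := fun b =>
    measurable_prodMk_left hE
  have h := integral_prior p (f := E.indicator 1) (measurable_one.indicator hE) (C := 1)
    fun x => by by_cases hx : x ∈ E <;> simp [hx]
  rw [integral_indicator_one hE] at h
  rw [h, ← integral_indicator_one (hm true), ← integral_indicator_one (hm false)]
  rfl

omit [Fintype V] in
lemma measurable_signal_apply (w : V) : Measurable fun x : Sample V => signal x w := by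
  have h : (fun x : Sample V => signal x w) =
      (fun q : Bool × Bool => if q.2 then q.1 else !q.1) ∘ fun x : Sample V => (x.1, x.2.1 w) := rfl
  rw [h]
  exact Measurable.of_discrete.comp (measurable_fst.prodMk (by fun_prop))

lemma measurable_action (G : SimpleGraph V) (σ : V → Strategy V) (w : V) :
    Measurable fun x : Sample V => action G σ x w :=
  measurable_play G σ (s := signal) (T := fun x => x.2.2.1) (ω := fun x => x.2.2.2)
    measurable_signal_apply (fun u => by fun_prop) (fun u => by fun_prop) w

omit [Fintype V] in
lemma measurable_signalsIn (b : Bool) (w : V) :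
    Measurable fun z : Noise V => signalsIn b z.1 w :=
  (measurable_signal_apply w).comp (measurable_prodMk_left (x := b))

lemma measurable_score {α : Type*} [MeasurableSpace α] {f g : α → Bool} (hf : Measurable f)
    (hg : Measurable g) : Measurable fun x => score (f x) (g x) :=
  (Measurable.of_discrete (f := fun q : Bool × Bool => score q.1 q.2)).comp (hf.prodMk hg)

/-- Scores `±1` make the learning quality affine in a mean, so that comparing strategies becomes
integrating a difference of scores. -/
lemma learningQuality_eq_integral (G : SimpleGraph V) (σ : V → Strategy V) (v : V) :
    learningQuality G p σ v = (1 + ∫ x, score (action G σ x v) x.1 ∂prior V p) / 2 := by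
  have hm : MeasurableSet {x : Sample V | action G σ x v = x.1} :=
    measurableSet_eq_fun (measurable_action G σ v) measurable_fst
  have hi : Integrable (fun x : Sample V => score (action G σ x v) x.1) (prior V p) :=
    integrable_of_abs_le (measurable_score (measurable_action G σ v) measurable_fst)
      fun x => (abs_score _ _).le
  have h1 : (1 : ℝ) + ∫ x, score (action G σ x v) x.1 ∂prior V p =
      ∫ x, (1 + score (action G σ x v) x.1) ∂prior V p := by
    rw [integral_add (integrable_const _) hi]; simp
  have h2 : ∀ x : Sample V, 1 + score (action G σ x v) x.1 =
      2 * {x : Sample V | action G σ x v = x.1}.indicator 1 x := by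
    intro x
    by_cases h : action G σ x v = x.1
    · rw [Set.indicator_of_mem (by exact h)]; simp [score, h]; norm_num
    · rw [Set.indicator_of_notMem (by exact h)]; simp [score, h]
  rw [h1]
  simp only [h2]
  rw [integral_const_mul, integral_indicator_one hm, learningQuality]
  ring

variable [DecidableEq V]

/-- Replacing one arrival time by an independent copy. -/
lemma measurePreserving_noise_update (v : V) :
    MeasurePreserving (fun q : unitInterval × Noise V =>
        ((q.2.1, Function.update q.2.2.1 v q.1, q.2.2.2) : Noise V))
      ((volume : Measure unitInterval).prod (noise V p)) (noise V p) := by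
  set P : Measure (V → Bool) := Measure.pi fun _ : V => bernoulliMeasure true false p
  set T : Measure (V → unitInterval) := volume with hT
  have hup : MeasurePreserving
      (fun q : unitInterval × (V → unitInterval) => Function.update q.2 v q.1)
      ((volume : Measure unitInterval).prod T) T := by
    rw [hT, volume_pi]; exact measurePreserving_update (fun _ : V => (volume : Measure unitInterval)) v
  have h1 := (measurePreserving_prodAssoc (volume : Measure unitInterval) P (T.prod T)).symm
  have h2 := (Measure.measurePreserving_swap (μ := (volume : Measure unitInterval))
    (ν := P)).prod (MeasurePreserving.id (T.prod T))
  have h3 := measurePreserving_prodAssoc P (volume : Measure unitInterval) (T.prod T)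
  have h4 := (MeasurePreserving.id P).prod
    (measurePreserving_prodAssoc (volume : Measure unitInterval) T T).symm
  have h5 := (MeasurePreserving.id P).prod (hup.prod (MeasurePreserving.id T))
  exact h5.comp (h4.comp (h3.comp (h2.comp h1)))

/-- Fubini's theorem for one arrival time. -/
lemma integral_noise_update (v : V) {F : Noise V → ℝ} (hF : Measurable F) {C : ℝ}
    (hC : ∀ z, |F z| ≤ C) :
    ∫ z, F z ∂noise V p =
        ∫ s : unitInterval, ∫ z, F (z.1, Function.update z.2.1 v s, z.2.2) ∂noise V p ∧
      ∫ z, F z ∂noise V p =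
        ∫ z, (∫ s : unitInterval, F (z.1, Function.update z.2.1 v s, z.2.2)) ∂noise V p := by
  have h := measurePreserving_noise_update p v
  have hi : Integrable F (noise V p) := integrable_of_abs_le hF hC
  have h1 := integral_map h.measurable.aemeasurable (f := F) (by rw [h.map_eq]; exact hi.1)
  rw [h.map_eq] at h1
  have hi' := h.integrable_comp_of_integrable hi
  rw [h1]
  exact ⟨integral_prod _ hi', integral_prod_symm _ hi'⟩

/-- Integrating out an arrival time that enters only through its comparison with a threshold. -/
lemma integral_noise_threshold (v : V) {g : Noise V → unitInterval} {Φ : Noise V → ℝ}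
    (hg : Measurable g) (hΦ : Measurable Φ) {C : ℝ} (hC : ∀ z, |Φ z| ≤ C)
    (hgv : ∀ z s, g (z.1, Function.update z.2.1 v s, z.2.2) = g z)
    (hΦv : ∀ z s, Φ (z.1, Function.update z.2.1 v s, z.2.2) = Φ z) :
    ∫ z, (if g z ≤ z.2.1 v then (1 : ℝ) else 0) * Φ z ∂noise V p =
      ∫ z, (1 - (g z : ℝ)) * Φ z ∂noise V p := by
  have hm : Measurable fun z : Noise V => (if g z ≤ z.2.1 v then (1 : ℝ) else 0) * Φ z :=
    (Measurable.ite (measurableSet_le hg (by fun_prop)) measurable_const measurable_const).mul hΦ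
  rw [(integral_noise_update p v hm fun z => abs_ite_mul_le (hC z)).2]
  simp only [hgv, hΦv, Function.update_self]
  refine integral_congr_ae (Filter.Eventually.of_forall fun z => ?_)
  simp only
  rw [integral_mul_const]
  congr 1
  have h : (fun s : unitInterval => if g z ≤ s then (1 : ℝ) else 0) =
      (Set.Ici (g z)).indicator 1 := by
    ext s; simp [Set.indicator]
  rw [h, integral_indicator_one measurableSet_Ici, measureReal_def, unitInterval.volume_Ici,
    ENNReal.toReal_ofReal (sub_nonneg.2 (g z).2.2)]

omit [DecidableEq V] in
/-- Integrals over the arrival times only. -/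
lemma integral_noise_times {f : (V → unitInterval) → ℝ} (hf : Measurable f) :
    ∫ z, f z.2.1 ∂noise V p = ∫ T, f T := by
  have h : MeasurePreserving (fun z : Noise V => z.2.1) (noise V p) volume :=
    measurePreserving_fst.comp measurePreserving_snd
  have h1 := integral_map h.measurable.aemeasurable (f := f)
    (by rw [h.map_eq]; exact hf.aestronglyMeasurable)
  rw [h.map_eq] at h1
  exact h1.symm

omit [DecidableEq V] in
/-- The correctness of a signal is independent of the arrival times. -/
lemma integral_noise_times_mul_score (u : V) (f : (V → unitInterval) → ℝ) :
    ∫ z, f z.2.1 * score (z.1 u) true ∂noise V p =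
      ∫ z, f z.2.1 * (2 * (p : ℝ) - 1) ∂noise V p := by
  have h1 : ∫ c : V → Bool, score (c u) true
      ∂(Measure.pi fun _ : V => bernoulliMeasure true false p) = 2 * p - 1 := by
    rw [integral_comp_eval (μ := fun _ : V => bernoulliMeasure true false p) (i := u)
      (f := fun a => score a true) (Measurable.of_discrete).aestronglyMeasurable,
      integral_bernoulliMeasure]
    simp [score]
    ring
  have h2 := integral_prod_mul (μ := Measure.pi fun _ : V => bernoulliMeasure true false p)
    (ν := (volume : Measure (V → unitInterval)).prod (volume : Measure (V → unitInterval)))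
    (fun c => score (c u) true) (fun q => f q.1)
  have h3 := integral_prod_mul (μ := Measure.pi fun _ : V => bernoulliMeasure true false p)
    (ν := (volume : Measure (V → unitInterval)).prod (volume : Measure (V → unitInterval)))
    (fun _ => 2 * (p : ℝ) - 1) (fun q => f q.1)
  rw [h1] at h2
  simp only [integral_const, probReal_univ, one_smul] at h3
  unfold noise
  simp only [mul_comm (f _)]
  rw [h2, h3]

end Noise

/-! ### What equilibrium says about a friend of `v`. -/

section Friend

variable {V : Type*} [Fintype V]

open Classical in
/-- The number of friends of `u` other than `v` that arrive before `u`. -/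
noncomputable def arrived (G : SimpleGraph V) (v u : V) (T : V → unitInterval) : ℕ :=
  (((G.neighborFinset u).erase v).filter fun j => T j < T u).card

open Classical in
/-- The strategy that follows the own signal if `v` is not observed and exactly `k` other friends
are, and otherwise agrees with `τ`. -/
noncomputable def followSignal (G : SimpleGraph V) (v u : V) (k : ℕ) (τ : Strategy V) :
    Strategy V :=
  fun i => if i.2 v = none ∧
      (((G.neighborFinset u).erase v).filter fun j => i.2 j ≠ none).card = k
    then (if i.1 then 1 else 0) else τ i

lemma measurable_arrived (G : SimpleGraph V) (v u : V) :
    Measurable fun T : V → unitInterval => arrived G v u T := by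
  classical
  simp only [arrived, Finset.card_filter]
  exact Finset.measurable_sum _ fun j _ => Measurable.ite
    (measurableSet_lt (measurable_pi_apply j) (measurable_pi_apply u)) measurable_const
    measurable_const

lemma arrived_update [DecidableEq V] {G : SimpleGraph V} {v u : V} (huv : u ≠ v)
    (T : V → unitInterval) (s : unitInterval) :
    arrived G v u (Function.update T v s) = arrived G v u T := by
  unfold arrived
  congr 1
  refine Finset.filter_congr fun j hj => ?_
  have hjv : j ≠ v := by
    rintro rfl
    simp at hj
  rw [Function.update_of_ne hjv, Function.update_of_ne huv]

lemma arrived_le (G : SimpleGraph V) (v u : V) (T : V → unitInterval) [DecidableEq V]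
    [DecidableRel G.Adj] : arrived G v u T ≤ ((G.neighborFinset u).erase v).card := by
  unfold arrived
  refine (Finset.card_filter_le _ _).trans (le_of_eq ?_)
  congr 1
  ext; simp

open Classical in
lemma play_followSignal {G : SimpleGraph V} {σ : V → Strategy V} {u v : V}
    (hvu : G.Adj v u) (k : ℕ) {s : V → Bool} {T ω : V → unitInterval} (hω : ω u < 1) :
    play G (Function.update σ u (followSignal G v u k (σ u))) s T ω u =
      if T u ≤ T v ∧ arrived G v u T = k then s u else play G σ s T ω u := by
  rw [play_update_self, play_eq G σ s T ω u]
  have h1 : observed G T (play G σ s T ω) u v = none ↔ T u ≤ T v := by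
    rw [observed_eq_none]
    simp [hvu.symm]
  have h2 : (((G.neighborFinset u).erase v).filter
      fun j => observed G T (play G σ s T ω) u j ≠ none).card = arrived G v u T := by
    unfold arrived
    refine congrArg Finset.card (Finset.filter_congr fun j hj => ?_)
    have hj' : G.Adj u j := by simpa using Finset.mem_of_mem_erase hj
    rw [Ne, observed_eq_none]
    simp [hj']
  unfold followSignal
  simp only [h1, h2]
  by_cases h : T u ≤ T v ∧ arrived G v u T = k
  · rw [if_pos h, if_pos h]
    cases hs : s u
    · simp
    · simpa using hω
  · rw [if_neg h, if_neg h]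

variable (p : unitInterval)

/-- An action prescribed with probability `1` is played only if the device is strictly below `1`;
this discards the exceptional null set. -/
lemma ae_noise_device_lt_one (u : V) : ∀ᵐ z ∂noise V p, z.2.2 u < 1 := by
  have h1 : MeasurePreserving (fun z : Noise V => z.2.2 u) (noise V p) volume :=
    (measurePreserving_eval (fun _ : V => (volume : Measure unitInterval)) u).comp
      (measurePreserving_snd.comp measurePreserving_snd)
  refine h1.quasiMeasurePreserving.ae (p := fun s => s < 1) ?_
  rw [ae_iff]
  have : {s : unitInterval | ¬ s < 1} = Set.Ici 1 := by ext; simp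
  rw [this, unitInterval.volume_Ici]
  simp

lemma ae_prior_device_lt_one (u : V) : ∀ᵐ x ∂prior V p, x.2.2.2 u < 1 :=
  (measurePreserving_snd (μ := bernoulliMeasure true false
    (⟨1 / 2, by norm_num, by norm_num⟩ : unitInterval))
    (ν := noise V p)).quasiMeasurePreserving.ae (ae_noise_device_lt_one p u)

variable {p}

/-- No agent gains by following his signal on the event that `v` is not observed and exactly `k`
other friends are. -/
lemma IsEquilibrium.integral_followSignal_nonneg {G : SimpleGraph V} {σ : V → Strategy V}
    (hσ : IsEquilibrium G p σ) {u v : V} (hvu : G.Adj v u) (k : ℕ) :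
    0 ≤ ∫ x, (if x.2.2.1 u ≤ x.2.2.1 v ∧ arrived G v u x.2.2.1 = k then (1 : ℝ) else 0) *
      (score (action G σ x u) x.1 - score (signal x u) x.1) ∂prior V p := by
  classical
  have h := hσ u (followSignal G v u k (σ u))
  rw [learningQuality_eq_integral, learningQuality_eq_integral] at h
  have hi : ∀ τ : V → Strategy V,
      Integrable (fun x : Sample V => score (action G τ x u) x.1) (prior V p) := fun τ =>
    integrable_of_abs_le (measurable_score (measurable_action G τ u) measurable_fst)
      fun x => (abs_score _ _).le
  have h' : 0 ≤ ∫ x, (score (action G σ x u) x.1 - score (action G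
      (Function.update σ u (followSignal G v u k (σ u))) x u) x.1) ∂prior V p := by
    rw [integral_sub (hi _) (hi _)]
    linarith
  refine h'.trans (le_of_eq (integral_congr_ae ?_))
  filter_upwards [ae_prior_device_lt_one p u] with x hx
  have := play_followSignal (σ := σ) hvu k (s := signal x) (T := x.2.2.1) hx
  simp only [action] at this ⊢
  rw [this]
  split_ifs <;> simp

lemma measurable_play_cut (G : SimpleGraph V) (σ : V → Strategy V) (b : Bool) (u : V) :
    Measurable fun z : Noise V => play G σ (signalsIn b z.1) z.2.1 z.2.2 u :=
  measurable_play G σ (measurable_signalsIn b) (fun w => by fun_prop) (fun w => by fun_prop) u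

/-- How well `u` does, for given noise, in state `b` and in the network without `v`. -/
noncomputable def cutScore (G : SimpleGraph V) (σ : V → Strategy V) (v u : V) (b : Bool)
    (z : Noise V) : ℝ :=
  score (play (cut G v) σ (signalsIn b z.1) z.2.1 z.2.2 u) b

lemma measurable_cutScore (G : SimpleGraph V) (σ : V → Strategy V) (v u : V) (b : Bool) :
    Measurable (cutScore G σ v u b) :=
  measurable_score (measurable_play_cut _ σ b u) measurable_const

lemma abs_cutScore (G : SimpleGraph V) (σ : V → Strategy V) (v u : V) (b : Bool) (z : Noise V) :
    |cutScore G σ v u b z| = 1 := abs_score _ _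

lemma cutScore_update [DecidableEq V] {G : SimpleGraph V} {σ : V → Strategy V} {v u : V}
    (huv : u ≠ v) (b : Bool) (z : Noise V) (s : unitInterval) :
    cutScore G σ v u b (z.1, Function.update z.2.1 v s, z.2.2) = cutScore G σ v u b z := by
  unfold cutScore
  rw [play_cut_congr huv (fun _ _ => rfl) (fun x hx => Function.update_of_ne hx _ _)
    (fun _ _ => rfl)]

/-- On `T u ≤ T v` the action of `u` is his action in the cut network, so `T v` enters only through
this comparison and integrates to the factor `1 - T u`. The correctness of the signal of `u` is
independent of the arrival times and may be replaced by its mean `2 * p - 1`. -/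
lemma IsEquilibrium.sum_integral_arrived_eq_nonneg {G : SimpleGraph V} {σ : V → Strategy V}
    (hσ : IsEquilibrium G p σ) {u v : V} (hvu : G.Adj v u) (k : ℕ) :
    0 ≤ ∑ b : Bool, ∫ z, (1 - (z.2.1 u : ℝ)) * ((if arrived G v u z.2.1 = k then (1 : ℝ) else 0) *
      (cutScore G σ v u b z - (2 * p - 1))) ∂noise V p := by
  classical
  have huv : u ≠ v := hvu.ne'
  have h := hσ.integral_followSignal_nonneg hvu k
  have harr : ∀ k, MeasurableSet {z : Noise V | arrived G v u z.2.1 = k} := fun k =>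
    ((measurable_arrived G v u).comp (measurable_fst.comp measurable_snd))
      (measurableSet_singleton k)
  have hk : Measurable fun z : Noise V => if arrived G v u z.2.1 = k then (1 : ℝ) else 0 :=
    Measurable.ite (harr k) measurable_const measurable_const
  have hT : Measurable fun z : Noise V => (z.2.1 u : ℝ) := by fun_prop
  have hT01 : ∀ z : Noise V, |1 - (z.2.1 u : ℝ)| ≤ 1 := fun z =>
    abs_le.2 ⟨by linarith [(z.2.1 u).2.2], by linarith [(z.2.1 u).2.1]⟩
  have hsig : Measurable fun z : Noise V => score (z.1 u) true :=
    measurable_score (by fun_prop) measurable_const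
  rw [integral_prior p (C := 2)] at h
  · have hb : ∀ b : Bool, ∫ z, (if z.2.1 u ≤ z.2.1 v ∧ arrived G v u z.2.1 = k then (1 : ℝ)
        else 0) * (score (action G σ (b, z) u) b - score (signal (b, z) u) b) ∂noise V p =
        ∫ z, (1 - (z.2.1 u : ℝ)) * ((if arrived G v u z.2.1 = k then (1 : ℝ) else 0) *
          (cutScore G σ v u b z - (2 * p - 1))) ∂noise V p := by
      intro b
      have hΦ : Measurable fun z : Noise V => (if arrived G v u z.2.1 = k then (1 : ℝ) else 0) *
          (cutScore G σ v u b z - score (z.1 u) true) :=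
        hk.mul ((measurable_cutScore G σ v u b).sub hsig)
      have hΦ2 : ∀ z : Noise V, |(if arrived G v u z.2.1 = k then (1 : ℝ) else 0) *
          (cutScore G σ v u b z - score (z.1 u) true)| ≤ 2 := fun z =>
        abs_ite_mul_le ((abs_sub _ _).trans (by rw [abs_cutScore, abs_score]; norm_num))
      have e1 : ∀ z : Noise V, (if z.2.1 u ≤ z.2.1 v ∧ arrived G v u z.2.1 = k then (1 : ℝ)
          else 0) * (score (action G σ (b, z) u) b - score (signal (b, z) u) b) =
          (if z.2.1 u ≤ z.2.1 v then (1 : ℝ) else 0) *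
            ((if arrived G v u z.2.1 = k then (1 : ℝ) else 0) *
              (cutScore G σ v u b z - score (z.1 u) true)) := by
        intro z
        by_cases hz : z.2.1 u ≤ z.2.1 v
        · have hplay : action G σ (b, z) u =
              play (cut G v) σ (signalsIn b z.1) z.2.1 z.2.2 u := play_eq_play_cut huv hz
          have hsg : score (signal (b, z) u) b = score (z.1 u) true := score_signalsIn b z.1 u
          simp only [hz, true_and, if_true, one_mul]
          rw [hplay, hsg]
          rfl
        · simp [hz]
      simp only [e1]
      rw [integral_noise_threshold p v (g := fun z => z.2.1 u) (by fun_prop) hΦ hΦ2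
        (fun z s => Function.update_of_ne huv _ _)
        (fun z s => by simp only [arrived_update huv, cutScore_update huv])]
      have i2 : ∀ f : Noise V → ℝ, Measurable f → (∀ z, |f z| ≤ 1) →
          Integrable (fun z : Noise V => ((1 - (z.2.1 u : ℝ)) *
          (if arrived G v u z.2.1 = k then (1 : ℝ) else 0)) * f z) (noise V p) := by
        intro f hf hf1
        refine integrable_of_abs_le (C := 1)
          (((measurable_const.sub hT).mul hk).mul hf) fun z => ?_
        rw [mul_comm (1 - _), mul_assoc]
        refine abs_ite_mul_le ?_
        rw [abs_mul]
        exact mul_le_one₀ (hT01 z) (abs_nonneg _) (hf1 z)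
      have hβ : |2 * (p : ℝ) - 1| ≤ 1 :=
        abs_le.2 ⟨by linarith [p.2.1], by linarith [p.2.2]⟩
      have e2 := integral_noise_times_mul_score p u (fun T => (1 - (T u : ℝ)) *
          (if arrived G v u T = k then (1 : ℝ) else 0))
      generalize 2 * (p : ℝ) - 1 = β at hβ e2 ⊢
      simp only [← mul_assoc, mul_sub (_ * _)]
      rw [integral_sub (i2 _ (measurable_cutScore G σ v u b) fun z => (abs_cutScore _ _ _ _ _ _).le)
          (i2 _ hsig fun z => (abs_score _ _).le),
        e2,
        ← integral_sub
          (i2 _ (measurable_cutScore G σ v u b) fun z => (abs_cutScore _ _ _ _ _ _).le)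
          (i2 _ measurable_const fun z => hβ)]
    simp only [hb] at h
    rw [Fintype.sum_bool]
    linarith
  · refine Measurable.mul (Measurable.ite ?_ measurable_const measurable_const) ?_
    · exact (measurableSet_le (by fun_prop) (by fun_prop)).inter ((harr k).preimage measurable_snd)
    · exact (measurable_score (measurable_action G σ u) measurable_fst).sub
        (measurable_score (measurable_signal_apply u) measurable_fst)
  · exact fun x => abs_ite_mul_le ((abs_sub _ _).trans (by rw [abs_score, abs_score]; norm_num))

end Friend

/-! ### Lower bound for the mean score of a friend before time `t`. -/

section Mean

variable {V : Type*} [Fintype V] {p : unitInterval}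

lemma integral_noise_arrives_before (u : V) (t : unitInterval) :
    ∫ z : Noise V, (if z.2.1 u < t then (1 : ℝ) else 0) ∂noise V p = t := by
  have hm : MeasurePreserving (fun z : Noise V => z.2.1 u) (noise V p) volume :=
    (measurePreserving_eval (fun _ : V => (volume : Measure unitInterval)) u).comp
      (measurePreserving_fst.comp measurePreserving_snd)
  have h : (fun z : Noise V => if z.2.1 u < t then (1 : ℝ) else 0) =
      ((fun z : Noise V => z.2.1 u) ⁻¹' Set.Iio t).indicator 1 := by
    ext z; simp [Set.indicator]
  rw [h, integral_indicator_one (hm.measurable measurableSet_Iio),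
    measureReal_def, hm.measure_preimage measurableSet_Iio.nullMeasurableSet,
    unitInterval.volume_Iio, ENNReal.toReal_ofReal t.2.1]

omit [Fintype V] in
lemma measurable_ite_lt (u : V) (t : unitInterval) :
    Measurable fun z : Noise V => if z.2.1 u < t then (1 : ℝ) else 0 :=
  Measurable.ite (measurableSet_lt (by fun_prop) measurable_const) measurable_const
    measurable_const

/-- In equilibrium a friend `u` of `v` does well on average over the event of arriving before `t`
in the network without `v`. -/
lemma IsEquilibrium.sum_integral_cutScore_ge {G : SimpleGraph V} {σ : V → Strategy V}
    (hσ : IsEquilibrium G p σ) {u v : V} (hvu : G.Adj v u) [DecidableRel G.Adj] {d : ℕ}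
    (hd : 2 ≤ d) (hdeg : d ≤ G.degree u) (t : unitInterval) :
    2 * ((2 * (p : ℝ) - 1) * t) - 4 * ((Real.pi + 2) / Real.sqrt ((d : ℝ) - 1)) ≤
      ∑ b : Bool, ∫ z, (if z.2.1 u < t then (1 : ℝ) else 0) * cutScore G σ v u b z
        ∂noise V p := by
  classical
  set N : Finset V := (G.neighborFinset u).erase v with hN
  have hcard : N.card + 1 = G.degree u := by
    rw [hN, Finset.card_erase_add_one (by simpa using hvu.symm),
      SimpleGraph.card_neighborFinset_eq_degree]
  have hN0 : N.card ≠ 0 := by omega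
  have huN : u ∉ N := by simp [hN]
  set β : ℝ := 2 * (p : ℝ) - 1 with hβ_def
  have hβ : |β| ≤ 1 := abs_le.2 ⟨by rw [hβ_def]; linarith [p.2.1], by rw [hβ_def]; linarith [p.2.2]⟩
  set E : (V → unitInterval) → ℝ := fun T => |(if T u < t then (1 : ℝ) else 0) -
    friendWeight N.card t (arrived G v u T) * (1 - T u)| with hE
  have harr : ∀ T : V → unitInterval, (N.filter fun j => T j < T u).card = arrived G v u T := by
    intro T
    unfold arrived
    congr 1
    ext j
    simp [hN]
  have harr_le : ∀ T, arrived G v u T ≤ N.card := fun T => arrived_le G v u T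
  have hEle : ∫ T, E T ≤ (Real.pi + 2) / Real.sqrt ((d : ℝ) - 1) := by
    have h := integral_abs_friendWeight_le huN hN0 t
    have h' : ∫ T, E T ≤ (Real.pi + 2) / Real.sqrt N.card := by
      refine le_trans (le_of_eq ?_) h
      refine integral_congr_ae (Filter.Eventually.of_forall fun T => ?_)
      simp only [hE, ← harr]
    refine h'.trans ?_
    have hd1 : (0 : ℝ) < (d : ℝ) - 1 := by
      have : (2 : ℝ) ≤ d := by exact_mod_cast hd
      linarith
    have hdN : (d : ℝ) - 1 ≤ N.card := by
      have : (d : ℝ) ≤ N.card + 1 := by exact_mod_cast (hcard ▸ hdeg)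
      linarith
    have := Real.pi_pos
    gcongr
  have hTm : Measurable fun T : V → unitInterval => (T u : ℝ) := by fun_prop
  have hwm : Measurable fun T : V → unitInterval => friendWeight N.card t (arrived G v u T) :=
    (measurable_from_nat (f := friendWeight N.card t)).comp (measurable_arrived G v u)
  have hEm : Measurable E := by
    refine Measurable.abs (Measurable.sub ?_ (hwm.mul (measurable_const.sub hTm)))
    exact Measurable.ite (measurableSet_lt (measurable_pi_apply u) measurable_const)
      measurable_const measurable_const
  have hT01 : ∀ T : V → unitInterval, 0 ≤ 1 - (T u : ℝ) ∧ 1 - (T u : ℝ) ≤ 1 := fun T =>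
    ⟨by linarith [(T u).2.2], by linarith [(T u).2.1]⟩
  have hwb : ∀ T : V → unitInterval,
      |friendWeight N.card t (arrived G v u T) * (1 - T u)| ≤ N.card + 1 := by
    intro T
    have h0 := friendWeight_nonneg (harr_le T) t
    rw [abs_of_nonneg (mul_nonneg h0 (hT01 T).1)]
    exact (mul_le_of_le_one_right h0 (hT01 T).2).trans (friendWeight_le (harr_le T) t)
  have hEb : ∀ T, |E T| ≤ 1 + (N.card + 1) := by
    intro T
    rw [hE, abs_abs]
    refine (abs_sub _ _).trans (add_le_add ?_ (hwb T))
    split_ifs <;> simp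
  have hEint : Integrable (fun z : Noise V => E z.2.1) (noise V p) :=
    integrable_of_abs_le (hEm.comp (by fun_prop)) fun z => hEb _
  have hXm : ∀ b, Measurable fun z => cutScore G σ v u b z - β := fun b =>
    (measurable_cutScore G σ v u b).sub measurable_const
  have hXb : ∀ b z, |cutScore G σ v u b z - β| ≤ 2 := fun b z =>
    (abs_sub _ _).trans (by rw [abs_cutScore]; linarith)
  -- The equilibrium inequalities for the single values of `k`, combined with the nonnegative
  -- weights `friendWeight`.
  set W : Bool → Noise V → ℝ := fun b z =>
    friendWeight N.card t (arrived G v u z.2.1) * (1 - z.2.1 u) * (cutScore G σ v u b z - β)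
    with hW
  have hWint : ∀ b, Integrable (W b) (noise V p) := fun b =>
    integrable_of_abs_le (C := (N.card + 1) * 2)
      (((hwm.mul (measurable_const.sub hTm)).comp (by fun_prop)).mul (hXm b)) fun z => by
        rw [hW, abs_mul]
        exact mul_le_mul (hwb _) (hXb b z) (abs_nonneg _) (by positivity)
  have hWsum : 0 ≤ ∑ b : Bool, ∫ z, W b z ∂noise V p := by
    have hint : ∀ b k, Integrable (fun z : Noise V => friendWeight N.card t k *
        ((1 - (z.2.1 u : ℝ)) * ((if arrived G v u z.2.1 = k then (1 : ℝ) else 0) *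
          (cutScore G σ v u b z - β)))) (noise V p) := by
      intro b k
      refine Integrable.const_mul (integrable_of_abs_le (C := 2) ?_ fun z => ?_) _
      · refine (measurable_const.sub (hTm.comp (by fun_prop))).mul
          (Measurable.mul (Measurable.ite ?_ measurable_const measurable_const) (hXm b))
        exact ((measurable_arrived G v u).comp (measurable_fst.comp measurable_snd))
          (measurableSet_singleton k)
      · rw [abs_mul, abs_of_nonneg (hT01 z.2.1).1]
        calc _ ≤ 1 * (2 : ℝ) := mul_le_mul (hT01 z.2.1).2 (abs_ite_mul_le (hXb b z))
              (abs_nonneg _) zero_le_one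
          _ = 2 := one_mul _
    have hWk : ∀ b z, W b z = ∑ k ∈ Finset.range (N.card + 1), friendWeight N.card t k *
        ((1 - (z.2.1 u : ℝ)) * ((if arrived G v u z.2.1 = k then (1 : ℝ) else 0) *
          (cutScore G σ v u b z - β))) := by
      intro b z
      rw [Finset.sum_eq_single_of_mem (arrived G v u z.2.1)
        (Finset.mem_range.2 (Nat.lt_succ_of_le (harr_le _)))]
      · rw [if_pos rfl, one_mul, ← mul_assoc]
      · intro k _ hk
        rw [if_neg hk.symm]; ring
    simp only [hWk]
    simp only [integral_finsetSum _ fun k _ => hint _ k, integral_const_mul]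
    rw [Finset.sum_comm]
    refine Finset.sum_nonneg fun k hk => ?_
    rw [← Finset.mul_sum]
    exact mul_nonneg (friendWeight_nonneg (Nat.lt_succ_iff.1 (Finset.mem_range.1 hk)) t)
      (hσ.sum_integral_arrived_eq_nonneg hvu k)
  have hb : ∀ b, ∫ z, W b z ∂noise V p - 2 * ((Real.pi + 2) / Real.sqrt ((d : ℝ) - 1)) ≤
      ∫ z, (if z.2.1 u < t then (1 : ℝ) else 0) * cutScore G σ v u b z ∂noise V p - β * t := by
    intro b
    have hi1 : Integrable (fun z : Noise V => (if z.2.1 u < t then (1 : ℝ) else 0) *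
        cutScore G σ v u b z) (noise V p) :=
      integrable_of_abs_le (C := 1) ((measurable_ite_lt u t).mul (measurable_cutScore G σ v u b))
        fun z => abs_ite_mul_le (abs_cutScore _ _ _ _ _ _).le
    have hi2 : Integrable (fun z : Noise V => (if z.2.1 u < t then (1 : ℝ) else 0)) (noise V p) :=
      integrable_of_abs_le (C := 1) (measurable_ite_lt u t) fun z => by split_ifs <;> simp
    -- Since `|cutScore - β| ≤ 2`, replacing the weight by the indicator of `T u < t` costs at most
    -- `2 * E` in each state.
    have hmono : ∫ z, (W b z - 2 * E z.2.1) ∂noise V p ≤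
        ∫ z, ((if z.2.1 u < t then (1 : ℝ) else 0) * cutScore G σ v u b z -
          β * (if z.2.1 u < t then (1 : ℝ) else 0)) ∂noise V p := by
      refine integral_mono ((hWint b).sub (hEint.const_mul 2)) (hi1.sub (hi2.const_mul β))
        fun z => ?_
      have h := neg_abs_le (((if z.2.1 u < t then (1 : ℝ) else 0) -
        friendWeight N.card t (arrived G v u z.2.1) * (1 - z.2.1 u)) *
          (cutScore G σ v u b z - β))
      rw [abs_mul] at h
      have h2 := mul_le_mul_of_nonneg_left (hXb b z) (abs_nonneg ((if z.2.1 u < t then (1 : ℝ)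
        else 0) - friendWeight N.card t (arrived G v u z.2.1) * (1 - z.2.1 u)))
      simp only [hW, hE]
      linarith
    rw [integral_sub (hWint b) (hEint.const_mul 2), integral_sub hi1 (hi2.const_mul β),
      integral_const_mul, integral_const_mul, integral_noise_times p hEm,
      integral_noise_arrives_before] at hmono
    linarith
  rw [Fintype.sum_bool] at hWsum ⊢
  have := hb true
  have := hb false
  linarith

omit [Fintype V] in
lemma measurable_flipOutcome : Measurable (flipOutcome : Outcome V → Outcome V) := by
  have hnot : Measurable fun b : Bool => !b := Measurable.of_discrete
  refine (hnot.comp measurable_fst).prodMk ((measurable_pi_lambda _ fun w => ?_).prodMk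
    ((measurable_pi_lambda _ fun w => ?_).prodMk (by fun_prop)))
  · exact hnot.comp (by fun_prop)
  · exact hnot.comp (by fun_prop)

/-- By symmetry, an agent does equally well in both states. -/
lemma IsStateSymmetric.integral_cutScore_eq {G : SimpleGraph V} {σ : V → Strategy V}
    (hsym : IsStateSymmetric G p σ) {u v : V} (huv : u ≠ v) {t : unitInterval} (ht : t < 1) :
    ∫ z, (if z.2.1 u < t then (1 : ℝ) else 0) * cutScore G σ v u true z ∂noise V p =
      ∫ z, (if z.2.1 u < t then (1 : ℝ) else 0) * cutScore G σ v u false z ∂noise V p := by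
  classical
  -- The symmetry concerns outcomes of the actual play. On `T u < t ≤ T v` the action of `u` is also
  -- that of the cut network, and the condition on `T v` contributes the independent factor `1 - t`,
  -- cancelled at the end because `t < 1`.
  set Ψ : Bool → Outcome V → ℝ := fun b y =>
    (if y.1 = b ∧ y.2.2.2 u < t ∧ t ≤ y.2.2.2 v then (1 : ℝ) else 0) * score (y.2.2.1 u) y.1
    with hΨ
  have hΨm : ∀ b, Measurable (Ψ b) := by
    intro b
    refine Measurable.mul (Measurable.ite ?_ measurable_const measurable_const)
      (measurable_score (by fun_prop) measurable_fst)
    exact (measurableSet_eq_fun measurable_fst measurable_const).inter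
      ((measurableSet_lt (by fun_prop) measurable_const).inter
        (measurableSet_le measurable_const (by fun_prop)))
  have hout : Measurable fun x : Sample V => ((x.1, signal x, action G σ x, x.2.2.1) : Outcome V) :=
    measurable_fst.prodMk ((measurable_pi_lambda _ measurable_signal_apply).prodMk
      ((measurable_pi_lambda _ fun w => measurable_action G σ w).prodMk (by fun_prop)))
  have hflip : ∀ y, Ψ true (flipOutcome y) = Ψ false y := by
    intro y
    simp only [hΨ, flipOutcome, score_not]
    cases y.1 <;> simp
  have hΨeq : ∫ y, Ψ true y ∂outcomeLaw G p σ = ∫ y, Ψ false y ∂outcomeLaw G p σ := by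
    conv_lhs => rw [← (show (outcomeLaw G p σ).map flipOutcome = outcomeLaw G p σ from hsym)]
    rw [integral_map measurable_flipOutcome.aemeasurable (hΨm true).aestronglyMeasurable]
    simp only [hflip]
  have hΨb : ∀ b y, |Ψ b y| ≤ 1 := fun b y => abs_ite_mul_le (abs_score _ _).le
  have hval : ∀ b, ∫ y, Ψ b y ∂outcomeLaw G p σ = (1 - (t : ℝ)) *
      (∫ z, (if z.2.1 u < t then (1 : ℝ) else 0) * cutScore G σ v u b z ∂noise V p) / 2 := by
    intro b
    have h1 : ∫ z, (if t ≤ z.2.1 v then (1 : ℝ) else 0) *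
        ((if z.2.1 u < t then (1 : ℝ) else 0) * cutScore G σ v u b z) ∂noise V p =
        (1 - (t : ℝ)) *
          ∫ z, (if z.2.1 u < t then (1 : ℝ) else 0) * cutScore G σ v u b z ∂noise V p := by
      rw [integral_noise_threshold p v (g := fun _ => t)
        (Φ := fun z => (if z.2.1 u < t then (1 : ℝ) else 0) * cutScore G σ v u b z)
        (C := 1) measurable_const
        ((measurable_ite_lt u t).mul (measurable_cutScore G σ v u b))
        (fun z => abs_ite_mul_le (abs_cutScore _ _ _ _ _ _).le) (fun _ _ => rfl)
        (fun z s => by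
          simp only [cutScore_update huv, Function.update_of_ne huv]), integral_const_mul]
    have h2 : ∀ b' (z : Noise V), Ψ b (b', signal (b', z), action G σ (b', z), z.2.1) =
        if b' = b then (if t ≤ z.2.1 v then (1 : ℝ) else 0) *
          ((if z.2.1 u < t then (1 : ℝ) else 0) * cutScore G σ v u b z) else 0 := by
      intro b' z
      by_cases hb : b' = b
      · subst hb
        by_cases hu : z.2.1 u < t
        · by_cases hv : t ≤ z.2.1 v
          · have hplay : action G σ (b', z) u =
                play (cut G v) σ (signalsIn b' z.1) z.2.1 z.2.2 u :=
              play_eq_play_cut huv (hu.le.trans hv)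
            simp only [hΨ, hu, hv, and_self, if_true, one_mul, hplay]
            rfl
          · simp [hΨ, hv]
        · simp [hΨ, hu]
      · simp [hΨ, hb]
    rw [outcomeLaw, integral_map hout.aemeasurable (hΨm b).aestronglyMeasurable,
      integral_prior p (f := fun x => Ψ b (x.1, signal x, action G σ x, x.2.2.1))
        ((hΨm b).comp hout) (fun x => hΨb b _)]
    simp only [h2]
    rw [← h1]
    cases b <;> simp
  rw [hval, hval] at hΨeq
  have ht' : (t : ℝ) < 1 := ht
  have h1t : (1 - (t : ℝ)) ≠ 0 := by linarith
  have := (div_left_inj' (two_ne_zero' ℝ)).1 hΨeq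
  exact mul_left_cancel₀ h1t this

/-- In a state-symmetric equilibrium a friend `u` of `v` does well in each state. -/
lemma IsEquilibrium.integral_cutScore_ge {G : SimpleGraph V} {σ : V → Strategy V}
    (hσ : IsEquilibrium G p σ) (hsym : IsStateSymmetric G p σ) {u v : V} (hvu : G.Adj v u)
    [DecidableRel G.Adj] {d : ℕ} (hd : 2 ≤ d) (hdeg : d ≤ G.degree u) {t : unitInterval}
    (ht : t < 1) (b : Bool) :
    (2 * (p : ℝ) - 1) * t - 2 * ((Real.pi + 2) / Real.sqrt ((d : ℝ) - 1)) ≤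
      ∫ z, (if z.2.1 u < t then (1 : ℝ) else 0) * cutScore G σ v u b z ∂noise V p := by
  have h1 := hσ.sum_integral_cutScore_ge hvu hd hdeg t
  have h2 := hsym.integral_cutScore_eq hvu.ne' ht
  rw [Fintype.sum_bool] at h1
  cases b <;> linarith

end Mean

/-! ### Independence across disjoint sets of agents, and Chebyshev's inequality. -/

section Independence

variable {V : Type*} [Fintype V] (p : unitInterval)

/-- All that is random about the agent `w` except for the state. -/
def ownNoise (w : V) (z : Noise V) : Bool × unitInterval × unitInterval :=
  (z.1 w, z.2.1 w, z.2.2 w)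

omit [Fintype V] in
lemma measurable_ownNoise (w : V) : Measurable (ownNoise w) := by
  unfold ownNoise; fun_prop

/-- Regrouping the coordinates by agent turns the noise into a product measure over the agents. -/
lemma iIndepFun_ownNoise : iIndepFun (fun w : V => ownNoise w) (noise V p) := by
  set B : Measure Bool := bernoulliMeasure true false p
  have h1 := measurePreserving_arrowProdEquivProdArrow Bool (unitInterval × unitInterval) V
    (fun _ => B) (fun _ => volume)
  have h2 := measurePreserving_arrowProdEquivProdArrow unitInterval unitInterval V
    (fun _ => volume) (fun _ => volume)
  have h3 := h1.symm.comp ((MeasurePreserving.id (Measure.pi fun _ : V => B)).prod h2.symm)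
  have h4 : MeasurePreserving (fun (z : Noise V) (w : V) => ownNoise w z) (noise V p)
      (Measure.pi fun _ : V => B.prod (volume.prod volume)) := h3
  rw [iIndepFun_iff_map_fun_eq_pi_map fun w => (measurable_ownNoise w).aemeasurable, h4.map_eq]
  congr 1
  funext w
  exact ((measurePreserving_eval _ w).comp h4).map_eq.symm

/-- Quantities determined by disjoint sets of agents are independent. -/
lemma indepFun_of_disjoint {A B : Finset V} (hAB : Disjoint A B) {f g : Noise V → ℝ}
    (hf : Measurable f) (hg : Measurable g)
    (hfA : ∀ z z', (∀ w ∈ A, ownNoise w z = ownNoise w z') → f z = f z')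
    (hgB : ∀ z z', (∀ w ∈ B, ownNoise w z = ownNoise w z') → g z = g z') :
    IndepFun f g (noise V p) := by
  classical
  have h := (iIndepFun_ownNoise (V := V) p).indepFun_finset A B hAB measurable_ownNoise
  have key : ∀ (A : Finset V) (f : Noise V → ℝ), Measurable f →
      (∀ z z', (∀ w ∈ A, ownNoise w z = ownNoise w z') → f z = f z') →
      ∃ F : (A → Bool × unitInterval × unitInterval) → ℝ, Measurable F ∧
        f = F ∘ fun z (i : A) => ownNoise (i : V) z := by
    intro A f hf hfA
    -- Coordinates outside `A` are filled with an arbitrary constant, which `f` does not see; this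
    -- exhibits `f` as a measurable function of the coordinates in `A`.
    set ext : (A → Bool × unitInterval × unitInterval) → V → Bool × unitInterval × unitInterval :=
      fun q w => if hw : w ∈ A then q ⟨w, hw⟩ else (false, 0, 0) with hext
    have hm : ∀ w, Measurable fun q => ext q w := by
      intro w
      by_cases hw : w ∈ A
      · simp only [hext, hw, dif_pos]; fun_prop
      · simp only [hext, hw, dif_neg, not_false_eq_true]; exact measurable_const
    refine ⟨fun q => f (fun w => (ext q w).1, fun w => (ext q w).2.1, fun w => (ext q w).2.2),
      hf.comp ?_, ?_⟩
    · exact (measurable_pi_lambda _ fun w => (hm w).fst).prodMk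
        ((measurable_pi_lambda _ fun w => (hm w).snd.fst).prodMk
          (measurable_pi_lambda _ fun w => (hm w).snd.snd))
    · funext z
      refine hfA _ _ fun w hw => ?_
      simp [ownNoise, hext, hw]
  obtain ⟨F, hF, rfl⟩ := key A f hf hfA
  obtain ⟨F', hF', rfl⟩ := key B g hg hgB
  exact h.comp hF hF'

end Independence

/-- A sum of pairwise independent random variables with a large mean is rarely nonpositive. -/
lemma measureReal_sum_nonpos_le {Ω ι : Type*} [MeasurableSpace Ω] {μ : Measure Ω}
    [IsProbabilityMeasure μ] {X : ι → Ω → ℝ} {s : Finset ι} (hX : ∀ i ∈ s, MemLp (X i) 2 μ)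
    (hind : Set.Pairwise (s : Set ι) fun i j => IndepFun (X i) (X j) μ) {M v : ℝ} (hM : 0 < M)
    (hmean : M ≤ ∑ i ∈ s, ∫ ω, X i ω ∂μ) (hv : ∑ i ∈ s, ∫ ω, X i ω ^ 2 ∂μ ≤ v) :
    μ.real {ω | ∑ i ∈ s, X i ω ≤ 0} ≤ v / M ^ 2 := by
  have hL : MemLp (∑ i ∈ s, X i) 2 μ := memLp_finsetSum' s hX
  have hE : ∫ ω, (∑ i ∈ s, X i) ω ∂μ = ∑ i ∈ s, ∫ ω, X i ω ∂μ := by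
    simp only [Finset.sum_apply]
    exact integral_finsetSum _ fun i hi => (hX i hi).integrable (by norm_num)
  have hvar : variance (∑ i ∈ s, X i) μ ≤ v := by
    rw [IndepFun.variance_sum hX hind]
    refine (Finset.sum_le_sum fun i hi => ?_).trans hv
    exact variance_le_expectation_sq (hX i hi).1
  have hsub : {ω | ∑ i ∈ s, X i ω ≤ 0} ⊆
      {ω | M ≤ |(∑ i ∈ s, X i) ω - ∫ ω, (∑ i ∈ s, X i) ω ∂μ|} := by
    intro ω hω
    have hω' : ∑ i ∈ s, X i ω ≤ 0 := hω
    rw [Set.mem_ofPred_eq, hE, Finset.sum_apply, abs_sub_comm]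
    refine le_trans ?_ (le_abs_self _)
    linarith
  have h := (measure_mono hsub).trans (meas_ge_le_variance_div_sq hL hM)
  have h0 : 0 ≤ variance (∑ i ∈ s, X i) μ / M ^ 2 := div_nonneg (variance_nonneg _ _) (sq_nonneg _)
  calc μ.real {ω | ∑ i ∈ s, X i ω ≤ 0} ≤ variance (∑ i ∈ s, X i) μ / M ^ 2 := by
        rw [measureReal_def]
        exact ENNReal.toReal_le_of_le_ofReal h0 h
    _ ≤ v / M ^ 2 := by gcongr

/-! ### Truncated votes of the friends. -/

section Vote

variable {V : Type*} [Fintype V] {p : unitInterval}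

/-- The contribution of the friend `u` to the vote at time `t`, if his play is truncated after `r`
steps of the recursion: `1` if he is right, `-1` if he is wrong, and `0` if he has not arrived. -/
noncomputable def vote (G : SimpleGraph V) (σ : V → Strategy V) (v : V) (r : ℕ) (b : Bool)
    (t : unitInterval) (u : V) (z : Noise V) : ℝ :=
  (if z.2.1 u < t then (1 : ℝ) else 0) *
    score (playN (cut G v) σ (signalsIn b z.1) z.2.1 z.2.2 r u) b

lemma measurable_truncScore (G : SimpleGraph V) (σ : V → Strategy V) (v : V) (r : ℕ) (b : Bool)
    (u : V) : Measurable fun z : Noise V =>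
      score (playN (cut G v) σ (signalsIn b z.1) z.2.1 z.2.2 r u) b :=
  measurable_score (measurable_playN _ σ (measurable_signalsIn b) (fun w => by fun_prop)
    (fun w => by fun_prop) r u) measurable_const

lemma measurable_vote (G : SimpleGraph V) (σ : V → Strategy V) (v : V) (r : ℕ) (b : Bool)
    (t : unitInterval) (u : V) : Measurable (vote G σ v r b t u) :=
  (measurable_ite_lt u t).mul (measurable_truncScore G σ v r b u)

omit [Fintype V] in
lemma abs_vote_le (G : SimpleGraph V) (σ : V → Strategy V) (v : V) (r : ℕ) (b : Bool)
    (t : unitInterval) (u : V) (z : Noise V) : |vote G σ v r b t u z| ≤ 1 :=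
  abs_ite_mul_le (abs_score _ _).le

/-- The squared vote is the indicator of `T u < t`. A second moment of order `t`, rather than `1`,
keeps the Chebyshev bound useful at early times. -/
lemma integral_vote_sq (G : SimpleGraph V) (σ : V → Strategy V) (v : V) (r : ℕ) (b : Bool)
    (t : unitInterval) (u : V) : ∫ z, vote G σ v r b t u z ^ 2 ∂noise V p = t := by
  rw [← integral_noise_arrives_before (p := p) u t]
  refine integral_congr_ae (Filter.Eventually.of_forall fun z => ?_)
  simp only [vote]
  rw [mul_pow, ← sq_abs (score _ _), abs_score]
  split_ifs <;> simp

omit [Fintype V] in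
lemma vote_congr {G : SimpleGraph V} {σ : V → Strategy V} {v : V} {r : ℕ} {b : Bool}
    {t : unitInterval} {u : {w : V // w ≠ v}} {z z' : Noise V}
    (h : ∀ x ∈ nbhd (without G v) r u, ownNoise (x : V) z = ownNoise (x : V) z') :
    vote G σ v r b t u z = vote G σ v r b t u z' := by
  simp only [ownNoise, Prod.mk.injEq] at h
  unfold vote
  rw [(h u (self_mem_nbhd _ _ _)).2.1, playN_cut_congr (w := u) (n := r)
    (s' := signalsIn b z'.1) (T' := z'.2.1) (ω' := z'.2.2)]
  · intro x hx; simp only [signalsIn, (h x hx).1]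
  · exact fun x hx => (h x hx).2.1
  · exact fun x hx => (h x hx).2.2

/-- The reason for truncating: each vote reads only the noise of its own `r`-neighborhood. -/
lemma indepFun_vote {G : SimpleGraph V} {σ : V → Strategy V} {v : V} {r : ℕ} {b : Bool}
    {t : unitInterval} {u u' : {w : V // w ≠ v}}
    (h : Disjoint (nbhd (without G v) r u) (nbhd (without G v) r u')) :
    IndepFun (vote G σ v r b t u) (vote G σ v r b t u') (noise V p) := by
  classical
  refine indepFun_of_disjoint p
    (A := ((nbhd (without G v) r u).toFinset).map (Function.Embedding.subtype _))
    (B := ((nbhd (without G v) r u').toFinset).map (Function.Embedding.subtype _))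
    ?_ (measurable_vote _ _ _ _ _ _ _) (measurable_vote _ _ _ _ _ _ _) ?_ ?_
  · rw [Finset.disjoint_map]
    exact Set.disjoint_toFinset.2 h
  · exact fun z z' hz => vote_congr fun x hx => hz x (by simpa using ⟨x.2, hx⟩)
  · exact fun z z' hz => vote_congr fun x hx => hz x (by simpa using ⟨x.2, hx⟩)

lemma measurableSet_noise_descends (G : SimpleGraph V) (t : unitInterval) (r : ℕ) (u : V) :
    MeasurableSet {T : V → unitInterval | T u < t ∧ Descends G T r u} :=
  (measurableSet_lt (measurable_pi_apply u) measurable_const).inter (measurableSet_descends _ r u)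

lemma measureReal_noise_times {A : Set (V → unitInterval)} (hA : MeasurableSet A) :
    (noise V p).real {z | z.2.1 ∈ A} = (volume : Measure (V → unitInterval)).real A := by
  have h : MeasurePreserving (fun z : Noise V => z.2.1) (noise V p) volume :=
    measurePreserving_fst.comp measurePreserving_snd
  rw [measureReal_def, measureReal_def, ← h.measure_preimage hA.nullMeasurableSet]
  rfl

open Classical in
/-- Truncating the play costs little. -/
lemma integral_vote_ge {G : SimpleGraph V} {σ : V → Strategy V} {v : V} {r D : ℕ} {b : Bool}
    {t : unitInterval} {u : {w : V // w ≠ v}}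
    (hD : ∀ x ∈ nbhd (without G v) r u, (without G v).degree x ≤ D) :
    ∫ z, (if z.2.1 u < t then (1 : ℝ) else 0) * cutScore G σ v u b z ∂noise V p -
        2 * ((D : ℝ) ^ r * ((t : ℝ) ^ (r + 1) / (r + 1).factorial)) ≤
      ∫ z, vote G σ v r b t u z ∂noise V p := by
  set A := {T : V → unitInterval | T u < t ∧ Descends (cut G v) T r u} with hA
  have hAm : MeasurableSet A := measurableSet_noise_descends (cut G v) t r u
  have hAz : MeasurableSet {z : Noise V | z.2.1 ∈ A} := hAm.preimage (by fun_prop)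
  have hle : (noise V p).real {z | z.2.1 ∈ A} ≤
      (D : ℝ) ^ r * ((t : ℝ) ^ (r + 1) / (r + 1).factorial) := by
    rw [measureReal_noise_times hAm]
    exact measureReal_descends_le G v D r u hD t
  have hi1 : Integrable (fun z : Noise V => (if z.2.1 u < t then (1 : ℝ) else 0) *
      cutScore G σ v u b z) (noise V p) :=
    integrable_of_abs_le (C := 1) ((measurable_ite_lt _ t).mul (measurable_cutScore G σ v u b))
      fun z => abs_ite_mul_le (abs_cutScore _ _ _ _ _ _).le
  have hi2 : Integrable ({z : Noise V | z.2.1 ∈ A}.indicator (1 : Noise V → ℝ)) (noise V p) :=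
    (integrable_const 1).indicator hAz
  have hi3 : Integrable (vote G σ v r b t u) (noise V p) :=
    integrable_of_abs_le (measurable_vote _ _ _ _ _ _ _) (abs_vote_le _ _ _ _ _ _ _)
  have h : ∫ z, ((if z.2.1 u < t then (1 : ℝ) else 0) * cutScore G σ v u b z -
      2 * {z : Noise V | z.2.1 ∈ A}.indicator (1 : Noise V → ℝ) z) ∂noise V p ≤
      ∫ z, vote G σ v r b t u z ∂noise V p := by
    -- Truncated and full scores agree unless a decreasing path of `r` edges starts at `u`, and
    -- always differ by at most `2`.
    refine integral_mono (hi1.sub (hi2.const_mul 2)) hi3 fun z => ?_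
    unfold vote
    by_cases ht : z.2.1 u < t
    · by_cases hd : Descends (cut G v) z.2.1 r u
      · have hz : z ∈ {z : Noise V | z.2.1 ∈ A} := ⟨ht, hd⟩
        have h1 := abs_le.1 (abs_cutScore G σ v u b z).le
        have h2 := abs_le.1
          (abs_score (playN (cut G v) σ (signalsIn b z.1) z.2.1 z.2.2 r u) b).le
        simp only [ht, if_true, one_mul, Set.indicator_of_mem hz, Pi.one_apply]
        linarith
      · have hz : z ∉ {z : Noise V | z.2.1 ∈ A} := fun h => hd h.2
        simp only [ht, if_true, one_mul, Set.indicator_of_notMem hz, playN_eq_play hd]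
        simp [cutScore]
    · have hz : z ∉ {z : Noise V | z.2.1 ∈ A} := fun h => ht h.1
      simp [ht, Set.indicator_of_notMem hz]
  rw [integral_sub hi1 (hi2.const_mul 2), integral_const_mul, integral_indicator_one hAz] at h
  linarith

end Vote

/-! ### The deviation of `v` to the majority rule. -/

section Majority

variable {V : Type*} [Fintype V] {p : unitInterval}

open Classical in
/-- The strategy of following the majority among the observed agents in `S`. -/
noncomputable def majority {v : V} (S : Finset {w : V // w ≠ v}) : Strategy V :=
  fun i => if (S.filter fun u : {w : V // w ≠ v} => i.2 u = some false).card <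
      (S.filter fun u : {w : V // w ≠ v} => i.2 u = some true).card
    then 1 else 0

-- The sum counts right minus wrong observed votes. If it were positive, the majority rule would
-- choose `b`; a tie yields `false`, and counts as a possible error in either state.
omit [Fintype V] in
open Classical in
lemma sum_score_nonpos_of_majority_wrong {G : SimpleGraph V} {v : V}
    {S : Finset {w : V // w ≠ v}} (hS : ∀ u ∈ S, G.Adj v u) {a : V → Bool}
    {T : V → unitInterval} {y : unitInterval} (hy : y < 1) {c b : Bool}
    (h : decide (y < majority S (c, observed G T a v)) ≠ b) :
    ∑ u ∈ S, (if T u < T v then (1 : ℝ) else 0) * score (a u) b ≤ 0 := by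
  have hobs : ∀ q : Bool, ((S.filter fun u : {w : V // w ≠ v} => observed G T a v u = some q).card : ℝ) =
      ∑ u ∈ S, if T u < T v ∧ a u = q then (1 : ℝ) else 0 := by
    intro q
    rw [Finset.card_filter, Nat.cast_sum]
    refine Finset.sum_congr rfl fun u hu => ?_
    by_cases ht : T u < T v <;> simp [observed, hS u hu, ht]
  have hsum : ∑ u ∈ S, (if T u < T v then (1 : ℝ) else 0) * score (a u) b =
      ((S.filter fun u : {w : V // w ≠ v} => observed G T a v u = some b).card : ℝ) -
        ((S.filter fun u : {w : V // w ≠ v} => observed G T a v u = some (!b)).card : ℝ) := by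
    rw [hobs, hobs, ← Finset.sum_sub_distrib]
    refine Finset.sum_congr rfl fun u _ => ?_
    by_cases ht : T u < T v <;> cases hb : b <;> cases ha : a u <;> simp [score, ht]
  rw [hsum, sub_nonpos, Nat.cast_le]
  unfold majority at h
  by_contra hlt
  rw [not_le] at hlt
  cases b
  · simp only [Bool.not_false] at hlt
    rw [if_neg (not_lt.2 hlt.le)] at h
    simp at h
  · simp only [Bool.not_true] at hlt
    rw [if_pos hlt] at h
    simp [hy] at h

/-- If `v` follows the majority, he errs only if there are long paths of decreasing arrival times
or the truncated vote goes wrong. -/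
lemma IsEquilibrium.one_sub_learningQuality_le {G : SimpleGraph V} {σ : V → Strategy V}
    (hσ : IsEquilibrium G p σ) {v : V} {S : Finset {w : V // w ≠ v}}
    (hS : ∀ u ∈ S, G.Adj v u) (r : ℕ) :
    1 - learningQuality G p σ v ≤
      (noise V p).real {z | ∃ u ∈ S, z.2.1 u < 1 ∧ Descends (cut G v) z.2.1 r u} +
      ((noise V p).real {z | ∑ u ∈ S, vote G σ v r true (z.2.1 v) u z ≤ 0} +
        (noise V p).real {z | ∑ u ∈ S, vote G σ v r false (z.2.1 v) u z ≤ 0}) / 2 := by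
  classical
  have hm : MeasurableSet {x : Sample V | action G (Function.update σ v (majority S)) x v = x.1} :=
    measurableSet_eq_fun (measurable_action _ _ v) measurable_fst
  have h := hσ v (majority S)
  have hwrong : 1 - learningQuality G p (Function.update σ v (majority S)) v =
      (prior V p).real {x | action G (Function.update σ v (majority S)) x v = x.1}ᶜ :=
    (probReal_compl_eq_one_sub hm).symm
  have hb : ∀ b : Bool, (noise V p).real
      {z | (b, z) ∈ {x | action G (Function.update σ v (majority S)) x v = x.1}ᶜ} ≤
      (noise V p).real {z | ∃ u ∈ S, z.2.1 u < 1 ∧ Descends (cut G v) z.2.1 r u} +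
        (noise V p).real {z | ∑ u ∈ S, vote G σ v r b (z.2.1 v) u z ≤ 0} := by
    intro b
    -- Outside the event of long decreasing paths, the observed actions are the truncated ones in
    -- the cut network, so a wrong majority is a nonpositive truncated vote.
    refine le_trans ?_ (measureReal_union_le _ _)
    refine ENNReal.toReal_mono (measure_ne_top _ _) (measure_mono_ae ?_)
    filter_upwards [ae_noise_device_lt_one p v] with z hy hz
    have hz' : play G (Function.update σ v (majority S)) (signal (b, z)) z.2.1 z.2.2 v ≠ b := hz
    rw [play_update_self] at hz'
    have hscore := sum_score_nonpos_of_majority_wrong hS hy hz'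
    by_cases hbad : ∃ u ∈ S, z.2.1 u < 1 ∧ Descends (cut G v) z.2.1 r u
    · exact Or.inl hbad
    · refine Or.inr (le_of_eq_of_le (Finset.sum_congr rfl fun u hu => ?_) hscore)
      unfold vote
      by_cases ht : z.2.1 u < z.2.1 v
      · have hd : ¬ Descends (cut G v) z.2.1 r u := fun hd =>
          hbad ⟨u, hu, ht.trans_le (z.2.1 v).2.2, hd⟩
        rw [playN_eq_play hd, ← play_eq_play_cut u.2 ht.le]
        rfl
      · simp [ht]
  rw [measureReal_prior p hm.compl] at hwrong
  have h1 := hb true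
  have h2 := hb false
  linarith

end Majority

/-! ### Error of the vote at fixed and at random times. -/

section Final

variable {V : Type*} [Fintype V] {p : unitInterval}

/-- The vote at the random arrival time of `v` is a mixture of votes at deterministic times. -/
lemma measureReal_sum_vote_nonpos_eq (G : SimpleGraph V) (σ : V → Strategy V) {v : V}
    (S : Finset {w : V // w ≠ v}) (r : ℕ) (b : Bool) :
    (noise V p).real {z | ∑ u ∈ S, vote G σ v r b (z.2.1 v) u z ≤ 0} =
      ∫ t : unitInterval, (noise V p).real {z | ∑ u ∈ S, vote G σ v r b t u z ≤ 0} := by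
  classical
  have hm1 : ∀ u : {w : V // w ≠ v}, Measurable fun z : Noise V =>
      vote G σ v r b (z.2.1 v) u z := by
    intro u
    refine Measurable.mul (Measurable.ite ?_ measurable_const measurable_const)
      (measurable_truncScore G σ v r b u)
    exact measurableSet_lt (by fun_prop) (by fun_prop)
  have hE : MeasurableSet {z : Noise V | ∑ u ∈ S, vote G σ v r b (z.2.1 v) u z ≤ 0} :=
    measurableSet_le (Finset.measurable_sum _ fun u _ => hm1 u) measurable_const
  have hEt : ∀ t, MeasurableSet {z : Noise V | ∑ u ∈ S, vote G σ v r b t u z ≤ 0} := fun t =>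
    measurableSet_le (Finset.measurable_sum _ fun u _ => measurable_vote G σ v r b t u)
      measurable_const
  have h := (integral_noise_update p v (F := {z : Noise V |
    ∑ u ∈ S, vote G σ v r b (z.2.1 v) u z ≤ 0}.indicator 1) (measurable_one.indicator hE) (C := 1)
    fun z => by
      by_cases hz : z ∈ {z : Noise V | ∑ u ∈ S, vote G σ v r b (z.2.1 v) u z ≤ 0}
      · rw [Set.indicator_of_mem hz]; simp
      · rw [Set.indicator_of_notMem hz]; simp).1
  rw [integral_indicator_one hE] at h
  rw [h]
  refine integral_congr_ae (Filter.Eventually.of_forall fun t => ?_)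
  simp only
  rw [← integral_indicator_one (hEt t)]
  refine integral_congr_ae (Filter.Eventually.of_forall fun z => ?_)
  -- Apart from the threshold, the votes do not involve `T v`, since the neighborhoods avoid `v`.
  have hv : ∀ u : {w : V // w ≠ v}, vote G σ v r b (Function.update z.2.1 v t v) u
      (z.1, Function.update z.2.1 v t, z.2.2) = vote G σ v r b t u z := by
    intro u
    rw [Function.update_self]
    refine vote_congr fun x _ => ?_
    simp only [ownNoise, Function.update_of_ne x.2]
  simp only [Set.indicator, Set.mem_ofPred_eq, hv]
  rfl

/-- The truncation loss is controlled by `psi`. -/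
lemma two_mul_pow_div_factorial_le_psi (d D : ℕ) {r : ℕ} (hr : 1 ≤ r) :
    2 * d * ((D : ℝ) ^ r / r.factorial) ≤ psi d r D := by
  unfold psi
  have hr0 : (0 : ℝ) < r := by exact_mod_cast hr
  -- One term of the exponential series: `r ^ r / r! ≤ e ^ r`.
  have h := Real.pow_div_factorial_le_exp (x := (r : ℝ)) hr0.le r
  have hexp : Real.exp (r : ℝ) = Real.exp 1 ^ r := by
    rw [← Real.exp_nat_mul, mul_one]
  rw [hexp] at h
  gcongr
  rw [div_pow, mul_pow, le_div_iff₀ (by positivity)]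
  calc (D : ℝ) ^ r / r.factorial * (r : ℝ) ^ r = (r : ℝ) ^ r / r.factorial * (D : ℝ) ^ r := by ring
    _ ≤ Real.exp 1 ^ r * (D : ℝ) ^ r := by gcongr

open Classical in
/-- The vote of the friends at a time `t` that is not too early is rarely wrong. -/
lemma IsEquilibrium.measureReal_sum_vote_nonpos_le {G : SimpleGraph V} {σ : V → Strategy V}
    (hσ : IsEquilibrium G p σ) (hsym : IsStateSymmetric G p σ) {v : V} {d r D : ℕ} (hd : 2 ≤ d)
    (hr : 1 ≤ r) {S : Finset {w : V // w ≠ v}} (hcard : S.card = d)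
    (hadj : ∀ u ∈ S, G.Adj v u ∧ d ≤ G.degree u)
    (hdis : ∀ u ∈ S, ∀ u' ∈ S, u ≠ u' →
      Disjoint (nbhd (without G v) r u) (nbhd (without G v) r u'))
    (hdeg : ∀ u ∈ S, ∀ w ∈ nbhd (without G v) r u, (without G v).degree w ≤ D)
    {x : ℝ} (hδ : 0 < 2 * (p : ℝ) - 1 - psi d r D)
    (hx : x = 1 / (Real.sqrt ((d : ℝ) - 1) * (2 * p - 1 - psi d r D)))
    {t : unitInterval} (ht1 : t < 1) (htx : 15 * x ≤ t) (b : Bool) :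
    (noise V p).real {z | ∑ u ∈ S, vote G σ v r b t u z ≤ 0} ≤ x := by
  set δ : ℝ := 2 * (p : ℝ) - 1 - psi d r D with hδ_def
  have hd2 : (2 : ℝ) ≤ d := by exact_mod_cast hd
  have hsq : 0 < Real.sqrt ((d : ℝ) - 1) := Real.sqrt_pos.2 (by linarith)
  have hx0 : 0 < x := by rw [hx]; positivity
  have ht0 : (0 : ℝ) < t := by linarith
  have ht1' : (t : ℝ) ≤ 1 := t.2.2
  have hψ := two_mul_pow_div_factorial_le_psi d D hr
  set κ : ℝ := (D : ℝ) ^ r / r.factorial with hκ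
  have hκ0 : 0 ≤ κ := by positivity
  -- After the truncation loss `δ * t` remains. The reweighting loss is `2(π + 2)δx ≤ 10.3 δx ≤
  -- (10.3 / 15) δt`, by `π < 3.15` and `15 x ≤ t`, which leaves more than `0.31 δt`.
  have hmean : ∀ u ∈ S, 31 / 100 * (δ * t) ≤ ∫ z, vote G σ v r b t u z ∂noise V p := by
    intro u hu
    have h1 := hσ.integral_cutScore_ge hsym (hadj u hu).1 hd (hadj u hu).2 ht1 b
    have h2 := integral_vote_ge (p := p) (σ := σ) (b := b) (t := t) (hdeg u hu)
    have h3 : (D : ℝ) ^ r * ((t : ℝ) ^ (r + 1) / (r + 1).factorial) ≤ κ * t := by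
      rw [hκ, div_mul_eq_mul_div, mul_div_assoc]
      gcongr
      · exact pow_le_of_le_one ht0.le ht1' (by omega)
      · omega
    have h4 : (Real.pi + 2) / Real.sqrt ((d : ℝ) - 1) = (Real.pi + 2) * (δ * x) := by
      rw [hx]; field_simp
    have h5 : (Real.pi + 2) * (δ * x) ≤ 515 / 100 * (δ * x) := by
      have := Real.pi_lt_d2
      gcongr
      linarith
    have h6 : δ * (15 * x) ≤ δ * t := by gcongr
    have h7 : 2 * κ ≤ psi d r D := by nlinarith
    have h8 : 2 * κ * t ≤ psi d r D * t := by gcongr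
    have h9 : δ * t = (2 * (p : ℝ) - 1) * t - psi d r D * t := by rw [hδ_def]; ring
    rw [h4] at h1
    have h11 : 0 < δ * t := by positivity
    linarith
  have hM : 0 < (d : ℝ) * (31 / 100 * (δ * t)) := by positivity
  refine (measureReal_sum_nonpos_le (X := fun u : {w : V // w ≠ v} => vote G σ v r b t u)
    (v := d * t)
    (fun u _ => MemLp.of_bound (measurable_vote G σ v r b t u).aestronglyMeasurable 1
      (Filter.Eventually.of_forall fun z => abs_vote_le G σ v r b t u z))
    (fun u hu u' hu' hne => indepFun_vote (hdis u hu u' hu' hne)) hM ?_ ?_).trans ?_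
  · rw [← hcard, ← nsmul_eq_mul]
    exact Finset.card_nsmul_le_sum _ _ _ hmean
  · simp only [integral_vote_sq, Finset.sum_const, hcard, nsmul_eq_mul, le_refl]
  -- The right side is `d / (d - 1)`. Hence the Chebyshev bound `d t / (0.31 d δ t)²` is at most `x²
  -- / (0.31² t)`, and this is at most `x` because `t ≥ 15 x` and `0.31² * 15 > 1`.
  · have hx2 : 1 ≤ d * (δ * x) ^ 2 := by
      have h1 : δ * x = 1 / Real.sqrt ((d : ℝ) - 1) := by rw [hx]; field_simp
      rw [h1, div_pow, Real.sq_sqrt (by linarith), one_pow, mul_one_div,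
        one_le_div (by linarith)]
      linarith
    rw [div_le_iff₀ (by positivity)]
    have h1 : (d : ℝ) * t * 1 ≤ d * t * (d * (δ * x) ^ 2) := by gcongr
    have h2 : (d : ℝ) * t * (d * (δ * x) ^ 2) = x * (d * δ) ^ 2 * t * x := by ring
    have h3 : x * (d * δ) ^ 2 * t * x ≤ x * (d * δ) ^ 2 * t * (t / 15) := by
      gcongr; linarith
    have h4 : 0 ≤ x * (d * δ) ^ 2 * t * t := by positivity
    nlinarith

end Final

end SocialLearning

/-! ### Assembly of the bounds. -/

theorem theorem1 {V : Type*} [Fintype V] (G : SimpleGraph V) (v : V) (p : unitInterval) (d r D : ℕ)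
    (hd : 2 ≤ d) (hr : 1 ≤ r) (hv : LocalLearningRequirement G v d r D)
    (hp : (1 + psi d r D) / 2 < (p : ℝ))
    (σ : V → Strategy V) (hσ : IsEquilibrium G p σ) (hsym : IsStateSymmetric G p σ) :
    1 - (psi d r D + 18 / (Real.sqrt ((d : ℝ) - 1) * (2 * (p : ℝ) - 1 - psi d r D)))
      ≤ learningQuality G p σ v := by
  classical
  obtain ⟨S, hcard, hadj, hdis, hdeg⟩ := hv
  have hδ : 0 < 2 * (p : ℝ) - 1 - psi d r D := by linarith
  set x : ℝ := 1 / (Real.sqrt ((d : ℝ) - 1) * (2 * (p : ℝ) - 1 - psi d r D)) with hx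
  have h18 : 18 / (Real.sqrt ((d : ℝ) - 1) * (2 * (p : ℝ) - 1 - psi d r D)) = 18 * x := by
    rw [hx, mul_one_div]
  rw [h18]
  have hd2 : (2 : ℝ) ≤ d := by exact_mod_cast hd
  have hsq : 0 < Real.sqrt ((d : ℝ) - 1) := Real.sqrt_pos.2 (by linarith)
  have hx0 : 0 < x := by rw [hx]; positivity
  have hψ := two_mul_pow_div_factorial_le_psi d D hr
  have hbad : (noise V p).real {z | ∃ u ∈ S, z.2.1 u < 1 ∧ Descends (cut G v) z.2.1 r u} ≤
      psi d r D := by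
    have hsub : {z : Noise V | ∃ u ∈ S, z.2.1 u < 1 ∧ Descends (cut G v) z.2.1 r u} ⊆
        ⋃ u ∈ S, {z | z.2.1 ∈ {T : V → unitInterval | T u < 1 ∧ Descends (cut G v) T r u}} := by
      rintro z ⟨u, hu, h⟩
      exact Set.mem_biUnion hu h
    refine (measureReal_mono hsub (measure_ne_top _ _)).trans
      ((measureReal_biUnion_finset_le _ _).trans ?_)
    have hle : ∀ u ∈ S, (noise V p).real
        {z | z.2.1 ∈ {T : V → unitInterval | T u < 1 ∧ Descends (cut G v) T r u}} ≤
        (D : ℝ) ^ r / r.factorial := by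
      intro u hu
      rw [measureReal_noise_times (measurableSet_noise_descends _ _ _ _)]
      refine (measureReal_descends_le G v D r u (hdeg u hu) 1).trans ?_
      rw [Set.Icc.coe_one, one_pow, mul_one_div]
      gcongr
      omega
    refine (Finset.sum_le_card_nsmul _ _ _ hle).trans ?_
    rw [hcard, nsmul_eq_mul]
    have : 0 ≤ (d : ℝ) * ((D : ℝ) ^ r / r.factorial) := by positivity
    linarith
  have hvote : ∀ b, (noise V p).real {z | ∑ u ∈ S, vote G σ v r b (z.2.1 v) u z ≤ 0} ≤
      16 * x := by
    intro b
    -- Up to time `15 * x` the error probability is bounded by `1`, afterwards by `x`, which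
    -- together integrate to at most `16 * x`. If `15 * x > 1` the claim is trivial.
    by_cases hx1 : 15 * x ≤ 1
    · rw [measureReal_sum_vote_nonpos_eq]
      set t₀ : unitInterval := ⟨15 * x, by positivity, hx1⟩ with ht₀
      have hi : Integrable fun t : unitInterval => (if t < t₀ then (1 : ℝ) else 0) :=
        integrable_of_abs_le (C := 1) (Measurable.ite measurableSet_Iio measurable_const
          measurable_const) fun t => by split_ifs <;> simp
      have hne : ∀ᵐ t : unitInterval, t < 1 := by
        rw [ae_iff]
        have : {t : unitInterval | ¬ t < 1} = Set.Ici 1 := by ext; simp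
        rw [this, unitInterval.volume_Ici]
        simp
      have hle : ∫ t : unitInterval, (noise V p).real {z | ∑ u ∈ S, vote G σ v r b t u z ≤ 0} ≤
          ∫ t : unitInterval, ((if t < t₀ then (1 : ℝ) else 0) + x) := by
        refine integral_mono_of_nonneg (Filter.Eventually.of_forall fun _ => measureReal_nonneg)
          (hi.add (integrable_const x)) ?_
        filter_upwards [hne] with t ht1
        by_cases ht : t < t₀
        · rw [if_pos ht]
          exact measureReal_le_one.trans (by linarith)
        · rw [if_neg ht, zero_add]
          exact hσ.measureReal_sum_vote_nonpos_le hsym hd hr hcard hadj hdis hdeg hδ hx ht1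
            (not_lt.1 ht) b
      rw [integral_add hi (integrable_const x), integral_unitInterval_lt (fun _ => 1)] at hle
      simp only [integral_const, intervalIntegral.integral_const, probReal_univ, smul_eq_mul,
        mul_one, one_mul, sub_zero, ht₀] at hle
      linarith
    · exact measureReal_le_one.trans (by linarith)
  have h := hσ.one_sub_learningQuality_le (fun u hu => (hadj u hu).1) r (S := S)
  have h1 := hvote true
  have h2 := hvote false
  linarith
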